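/- Let $m,n,k$ be integers with $1 \le k < \min\{m,n\}$. For $d\ge 1$ let $\mathcal H_d=\mathbb C^d$ denote the complex Hilbert space of dimension $d$. Every vector $v\in\mathcal H_m\otimes\mathcal H_n$ has a Schmidt decomposition $v=\sum_{i=1}^{\min\{m,n\}}\alpha_i\, a_i\otimes b_i$ with $\alpha_1\ge\alpha_2\ge\cdots\ge 0$ and with orthonormal families $(a_i)$ in $\mathcal H_m$ and $(b_i)$ in $\mathcal H_n$. The $\alpha_i$ (the Schmidt coefficients of $v$) are the singular values of the operator $A_v:\mathcal H_n\to\mathcal H_m$ obtained from $v$ by extending $a\otimes b\mapsto ab^{T}$ linearly. Put $$\|v\|_{s(k)}:=\Big(\sum_{i=1}^k\alpha_i^2\Big)^{1/2}=\sup\big\{|\langle w,v\rangle| : \|w\|=1,\ \operatorname{rank}A_w\le k\big\}.$$ Let $U$ be a linear operator on $\mathcal H_m\otimes\mathcal H_n$. Then $\|Uv\|_{s(k)}=\|v\|_{s(k)}$ for all $v\in\mathcal H_m\otimes\mathcal H_n$ if and only if $U$ is unitary and there are unitary operators $W$ on $\mathcal H_m$ and $Y$ on $\mathcal H_n$ such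 that either $U=W\otimes Y$, or $m=n$ and $U=S(W\otimes Y)$, where $S$ is the swap operator $S(a\otimes b)=b\otimes a$ on $\mathcal H_n\otimes\mathcal H_n$. -/

import Mathlib

open scoped TensorProduct

noncomputable section

namespace SchmidtNorm

/-- The complex Hilbert space of dimension `n`, with its standard basis. -/
abbrev H (n : ℕ) : Type := EuclideanSpace ℂ (Fin n)

/-- The vector-operator isomorphism `v ↦ A_v`, the linear map `H_m ⊗ H_n → L(H_n, H_m)` that sends
`a ⊗ b` to the operator with matrix `a bᵀ` (that is, `x ↦ (∑ j, b j * x j) • a`). -/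
def toOp (m n : ℕ) : (H m ⊗[ℂ] H n) →ₗ[ℂ] (H n →ₗ[ℂ] H m) :=
  TensorProduct.lift <| LinearMap.mk₂ ℂ
    (fun a b => Matrix.toEuclideanLin (Matrix.vecMulVec a.ofLp b.ofLp))
    (fun a a' b => by simp [Matrix.add_vecMulVec])
    (fun c a b => by simp [Matrix.smul_vecMulVec])
    (fun a b b' => by simp [Matrix.vecMulVec_add])
    (fun c a b => by simp [Matrix.vecMulVec_smul])

/-- The Schmidt coefficients of `v`, in decreasing order and numbered from `0`: the singular values
of `A_v`, continued by zeros. -/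
def schmidtCoeff {m n : ℕ} (v : H m ⊗[ℂ] H n) (i : ℕ) : ℝ :=
  (toOp m n v).singularValues i

/-- The Schmidt rank of `v`: the rank of `A_v`. -/
def schmidtRank {m n : ℕ} (v : H m ⊗[ℂ] H n) : ℕ :=
  Module.finrank ℂ (LinearMap.range (toOp m n v))

/-- The norm `‖v‖_{s(k)}`: the square root of the sum of the squares of the `k` largest Schmidt
coefficients. -/
def sNorm {m n : ℕ} (k : ℕ) (v : H m ⊗[ℂ] H n) : ℝ :=
  √(∑ i ∈ Finset.range k, schmidtCoeff v i ^ 2)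

/-- For `m = n`, the identification of `H_m` with `H_n` (same coordinates). -/
def ident {m n : ℕ} (h : m = n) : H m ≃ₗᵢ[ℂ] H n :=
  LinearIsometryEquiv.piLpCongrLeft 2 ℂ ℂ (finCongr h)

/-- For `m = n`, the swap operator `S (a ⊗ b) = b ⊗ a` on `H_m ⊗ H_n`. -/
def swapOp {m n : ℕ} (h : m = n) : (H m ⊗[ℂ] H n) →ₗ[ℂ] (H m ⊗[ℂ] H n) :=
  TensorProduct.map (ident h.symm).toLinearMap (ident h).toLinearMap ∘ₗ
    (TensorProduct.comm ℂ (H m) (H n)).toLinearMap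

theorem swapOp_tmul {n : ℕ} (a b : H n) : swapOp rfl (a ⊗ₜ[ℂ] b) = b ⊗ₜ[ℂ] a := by
  have h (x : H n) : ident (rfl : n = n) x = x := by
    ext i; simp [ident, LinearIsometryEquiv.piLpCongrLeft_apply]
  simp [swapOp, h]

theorem toOp_tmul_apply {m n : ℕ} (a : H m) (b x : H n) :
    toOp m n (a ⊗ₜ[ℂ] b) x = (∑ j, b j * x j) • a := by
  ext i
  simp [toOp, Matrix.toLpLin_apply, Matrix.vecMulVec_mulVec, dotProduct, mul_comm]

/-- The inner product of `H_m ⊗ H_n` is the Hilbert-Schmidt inner product of operators. -/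
theorem inner_eq_sum_toOp {m n : ℕ} {ι : Type*} [Fintype ι] (g : OrthonormalBasis ι ℂ (H n))
    (w v : H m ⊗[ℂ] H n) :
    inner ℂ w v = ∑ i, inner ℂ (toOp m n w (g i)) (toOp m n v (g i)) := by
  induction w using TensorProduct.induction_on with
  | zero => simp
  | add x y hx hy => simp [inner_add_left, hx, hy, Finset.sum_add_distrib]
  | tmul a b =>
    induction v using TensorProduct.induction_on with
    | zero => simp
    | add x y hx hy => simp only [inner_add_right, hx, hy, map_add, LinearMap.add_apply,
        Finset.sum_add_distrib]
    | tmul c d =>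
      have key (b x : H n) : (∑ j, b j * x j) = inner ℂ (WithLp.toLp 2 (star b.ofLp) : H n) x := by
        simp [PiLp.inner_apply, mul_comm]
      simp only [TensorProduct.inner_tmul, toOp_tmul_apply, inner_smul_left, inner_smul_right, key]
      have h2 := g.sum_inner_mul_inner (WithLp.toLp 2 (star d.ofLp) : H n)
        (WithLp.toLp 2 (star b.ofLp))
      have h3 : inner ℂ (WithLp.toLp 2 (star d.ofLp) : H n) (WithLp.toLp 2 (star b.ofLp)) =
          inner ℂ b d := by
        simp [PiLp.inner_apply, mul_comm]
      rw [← h3, ← h2, Finset.mul_sum]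
      refine Finset.sum_congr rfl fun i _ => ?_
      rw [inner_conj_symm]
      ring

theorem exists_singular_basis {m n : ℕ} (A : H n →ₗ[ℂ] H m) :
    ∃ e : OrthonormalBasis (Fin n) ℂ (H n),
      ∀ i j, inner ℂ (A (e i)) (A (e j)) = if i = j then ((A.singularValues i ^ 2 : ℝ) : ℂ) else 0 := by
  have hn : Module.finrank ℂ (H n) = n := by simp
  refine ⟨A.isSymmetric_adjoint_comp_self.eigenvectorBasis hn, fun i j => ?_⟩
  have h := A.isSymmetric_adjoint_comp_self.apply_eigenvectorBasis hn j
  rw [← LinearMap.adjoint_inner_right, ← LinearMap.comp_apply, h, inner_smul_right,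
    OrthonormalBasis.inner_eq_ite, A.sq_singularValues_fin hn i]
  split_ifs with hij
  · subst hij; simp
  · simp

/-- Ky Fan's inequality. -/
theorem sum_norm_sq_le {m n k : ℕ} (A : H n →ₗ[ℂ] H m)
    (g : OrthonormalBasis (Fin n) ℂ (H n)) :
    ∑ i : Fin n with i.val < k, ‖A (g i)‖ ^ 2 ≤ ∑ i ∈ Finset.range k, A.singularValues i ^ 2 := by
  obtain ⟨e, he⟩ := exists_singular_basis A
  have hnorm (x : H n) : ‖A x‖ ^ 2 = ∑ j : Fin n, A.singularValues j ^ 2 * ‖inner ℂ (e j) x‖ ^ 2 := by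
    have h1 : ((‖A x‖ ^ 2 : ℝ) : ℂ) = inner ℂ (A x) (A x) := by
      rw [inner_self_eq_norm_sq_to_K]; norm_cast
    have h2 : A x = ∑ j, inner ℂ (e j) x • A (e j) := by
      conv_lhs => rw [← e.sum_repr' x]
      simp
    apply Complex.ofReal_injective
    rw [h1, h2]
    simp only [sum_inner, inner_sum, inner_smul_left, inner_smul_right, he]
    push_cast
    refine Finset.sum_congr rfl fun j _ => ?_
    rw [Finset.sum_eq_single j]
    · rw [if_pos rfl, ← mul_assoc, Complex.mul_conj,
        Complex.normSq_eq_norm_sq]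
      push_cast; ring
    · intro b _ hb; simp [hb]
    · simp
  set c : Fin n → ℝ := fun j => ∑ i : Fin n with i.val < k, ‖inner ℂ (e j) (g i)‖ ^ 2 with hc
  have hc0 j : 0 ≤ c j := Finset.sum_nonneg fun _ _ => by positivity
  have hc1 j : c j ≤ 1 := by
    calc c j ≤ ∑ i, ‖inner ℂ (e j) (g i)‖ ^ 2 :=
          Finset.sum_le_sum_of_subset_of_nonneg (Finset.filter_subset _ _)
            fun _ _ _ => by positivity
      _ = 1 := by rw [g.sum_sq_norm_inner_left]; simp
  have hcs : ∑ j, c j = ((Finset.univ.filter fun i : Fin n => i.val < k).card : ℝ) := by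
    rw [hc, Finset.sum_comm]
    simp [e.sum_sq_norm_inner_right]
  have hL : ∑ i : Fin n with i.val < k, ‖A (g i)‖ ^ 2 = ∑ j : Fin n, A.singularValues j ^ 2 * c j := by
    simp only [hnorm, hc, Finset.mul_sum]
    rw [Finset.sum_comm]
  have hR : ∑ i : Fin n with i.val < k, A.singularValues i.val ^ 2 ≤
      ∑ i ∈ Finset.range k, A.singularValues i ^ 2 := by
    rw [← Finset.sum_image (f := fun i => A.singularValues i ^ 2) (g := Fin.val)
      (fun a _ b _ h => Fin.ext h)]
    refine Finset.sum_le_sum_of_subset_of_nonneg ?_ fun _ _ _ => by positivity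
    intro i hi
    simp only [Finset.mem_image, Finset.mem_filter] at hi
    obtain ⟨a, ha, rfl⟩ := hi
    simpa using ha.2
  refine le_trans ?_ hR
  rw [hL]
  set t := A.singularValues k ^ 2 with ht
  have hmono : ∀ j : Fin n, (A.singularValues j ^ 2 - t) * c j ≤
      if j.val < k then A.singularValues j ^ 2 - t else 0 := by
    intro j
    split_ifs with hj
    · have := pow_le_pow_left₀ (A.singularValues_nonneg k) (A.singularValues_antitone hj.le) 2
      nlinarith [hc1 j]
    · have := pow_le_pow_left₀ (A.singularValues_nonneg j)
        (A.singularValues_antitone (not_lt.1 hj)) 2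
      nlinarith [hc0 j]
  have hsum := Finset.sum_le_sum fun j (_ : j ∈ Finset.univ) => hmono j
  rw [← Finset.sum_filter, Finset.sum_sub_distrib] at hsum
  simp only [sub_mul, Finset.sum_sub_distrib, ← Finset.mul_sum, hcs, Finset.sum_const,
    nsmul_eq_mul] at hsum
  linarith

/-- The description of `‖v‖_{s(k)}` as a supremum over the unit vectors of Schmidt rank at most
`k`. -/
theorem sNorm_eq_sSup {m n : ℕ} (k : ℕ) (v : H m ⊗[ℂ] H n) :
    sNorm k v = sSup {r : ℝ | ∃ w : H m ⊗[ℂ] H n, ‖w‖ = 1 ∧ schmidtRank w ≤ k ∧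
      r = ‖inner ℂ w v‖} := by
  have hub : ∀ r ∈ {r : ℝ | ∃ w : H m ⊗[ℂ] H n, ‖w‖ = 1 ∧ schmidtRank w ≤ k ∧
      r = ‖inner ℂ w v‖}, r ≤ sNorm k v := by
    rintro r ⟨w, hw, hr, rfl⟩
    obtain ⟨g, hg⟩ := exists_singular_basis (toOp m n w)
    have hz : ∀ i : Fin n, ¬ i.val < k → toOp m n w (g i) = 0 := by
      intro i hi
      have h0 : (toOp m n w).singularValues i = 0 :=
        (LinearMap.singularValues_eq_zero_iff_le_finrank_range _).2 (hr.trans (not_lt.1 hi))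
      have := hg i i
      simpa [h0] using this
    have h1 : inner ℂ w v =
        ∑ i : Fin n with i.val < k, inner ℂ (toOp m n w (g i)) (toOp m n v (g i)) := by
      rw [inner_eq_sum_toOp g, Finset.sum_filter]
      refine Finset.sum_congr rfl fun i _ => ?_
      split_ifs with hi
      · rfl
      · simp [hz i hi]
    have hw2 : ∑ i : Fin n with i.val < k, ‖toOp m n w (g i)‖ ^ 2 ≤ 1 := by
      have h2 : (1 : ℝ) = ∑ i, ‖toOp m n w (g i)‖ ^ 2 := by
        apply Complex.ofReal_injective
        have h3 := (inner_self_eq_norm_sq_to_K (𝕜 := ℂ) w).symm.trans (inner_eq_sum_toOp g w w)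
        simpa [inner_self_eq_norm_sq_to_K, hw] using h3
      rw [h2]
      exact Finset.sum_le_sum_of_subset_of_nonneg (Finset.filter_subset _ _)
            fun _ _ _ => by positivity
    rw [h1, sNorm]
    apply Real.le_sqrt_of_sq_le
    calc ‖∑ i : Fin n with i.val < k, inner ℂ (toOp m n w (g i)) (toOp m n v (g i))‖ ^ 2
        ≤ (∑ i : Fin n with i.val < k, ‖toOp m n w (g i)‖ * ‖toOp m n v (g i)‖) ^ 2 := by
          gcongr
          exact (norm_sum_le _ _).trans (Finset.sum_le_sum fun _ _ => norm_inner_le_norm _ _)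
      _ ≤ (∑ i : Fin n with i.val < k, ‖toOp m n w (g i)‖ ^ 2) *
          ∑ i : Fin n with i.val < k, ‖toOp m n v (g i)‖ ^ 2 :=
          Finset.sum_mul_sq_le_sq_mul_sq _ _ _
      _ ≤ 1 * ∑ i : Fin n with i.val < k, ‖toOp m n v (g i)‖ ^ 2 := by gcongr
      _ ≤ ∑ i ∈ Finset.range k, schmidtCoeff v i ^ 2 := by
          rw [one_mul]; exact sum_norm_sq_le _ g
  refine le_antisymm ?_ (Real.sSup_le hub (Real.sqrt_nonneg _))
  by_cases hs : sNorm k v = 0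
  · rw [hs]
    refine Real.sSup_nonneg ?_
    rintro r ⟨w, -, -, rfl⟩
    positivity
  obtain ⟨e, he⟩ := exists_singular_basis (toOp m n v)
  set A := toOp m n v with hA
  let w : H m ⊗[ℂ] H n := ∑ i : Fin n with i.val < k,
    A (e i) ⊗ₜ[ℂ] (WithLp.toLp 2 (star (e i).ofLp) : H n)
  have hwx (x : H n) : toOp m n w x = ∑ i : Fin n with i.val < k, inner ℂ (e i) x • A (e i) := by
    simp only [w, map_sum, LinearMap.sum_apply, toOp_tmul_apply]
    refine Finset.sum_congr rfl fun i _ => ?_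
    congr 1
    simp [PiLp.inner_apply, mul_comm]
  have hwe (j : Fin n) : toOp m n w (e j) = if j.val < k then A (e j) else 0 := by
    rw [hwx, Finset.sum_filter, Finset.sum_eq_single j]
    · simp
    · intro b _ hb
      simp [hb]
    · simp
  have hfull : ∑ i : Fin n with i.val < k, A.singularValues i ^ 2 = sNorm k v ^ 2 := by
    rw [sNorm, Real.sq_sqrt (Finset.sum_nonneg fun _ _ => by positivity)]
    rw [← Finset.sum_image (f := fun i => A.singularValues i ^ 2) (g := Fin.val)
      (fun a _ b _ h => Fin.ext h)]
    refine Finset.sum_subset ?_ ?_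
    · intro i hi
      simp only [Finset.mem_image, Finset.mem_filter] at hi
      obtain ⟨a, ha, rfl⟩ := hi
      simpa using ha.2
    · intro i hi hni
      have : A.singularValues i = 0 := by
        apply LinearMap.singularValues_of_finrank_le
        by_contra hlt
        apply hni
        simp only [Finset.mem_image, Finset.mem_filter]
        exact ⟨⟨i, by simpa using hlt⟩, ⟨Finset.mem_univ _, by simpa using hi⟩, rfl⟩
      simp [this]
  have hwv : inner ℂ w v = ((sNorm k v ^ 2 : ℝ) : ℂ) := by
    rw [inner_eq_sum_toOp e, ← hfull, Finset.sum_filter]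
    push_cast
    refine Finset.sum_congr rfl fun j _ => ?_
    rw [hwe]
    split_ifs with hj
    · rw [← hA, he]; simp
    · simp
  have hww : ‖w‖ = sNorm k v := by
    have h1 : inner ℂ w w = ((sNorm k v ^ 2 : ℝ) : ℂ) := by
      rw [inner_eq_sum_toOp e, ← hfull, Finset.sum_filter]
      push_cast
      refine Finset.sum_congr rfl fun j _ => ?_
      rw [hwe]
      split_ifs with hj
      · rw [he]; simp
      · simp
    have h3 := (inner_self_eq_norm_sq_to_K (𝕜 := ℂ) w).symm.trans h1
    have h2 : ‖w‖ ^ 2 = sNorm k v ^ 2 := Complex.ofReal_injective (by simpa using h3)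
    exact (sq_eq_sq₀ (norm_nonneg _) (Real.sqrt_nonneg _)).1 h2
  have hrank : schmidtRank w ≤ k := by
    have hsub : LinearMap.range (toOp m n w) ≤ Submodule.span ℂ
        (((Finset.univ.filter fun i : Fin n => i.val < k).image fun i => A (e i) : Finset (H m)) :
          Set (H m)) := by
      rintro _ ⟨x, rfl⟩
      rw [hwx]
      refine Submodule.sum_mem _ fun i hi => Submodule.smul_mem _ _ (Submodule.subset_span ?_)
      exact Finset.mem_coe.2 (Finset.mem_image_of_mem _ hi)
    refine (Submodule.finrank_mono hsub).trans ((finrank_span_finset_le_card _).trans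
      (Finset.card_image_le.trans ?_))
    rw [← Finset.card_image_of_injective _ Fin.val_injective]
    calc _ ≤ (Finset.range k).card := Finset.card_le_card (by
            intro i hi
            simp only [Finset.mem_image, Finset.mem_filter] at hi
            obtain ⟨a, ha, rfl⟩ := hi
            simpa using ha.2)
      _ = k := Finset.card_range k
  have h0 : 0 ≤ sNorm k v := Real.sqrt_nonneg _
  refine le_csSup ⟨_, hub⟩ ⟨((sNorm k v)⁻¹ : ℂ) • w, ?_, ?_, ?_⟩
  · rw [norm_smul, hww, norm_inv, Complex.norm_real, Real.norm_of_nonneg h0,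
      inv_mul_cancel₀ hs]
  · refine le_trans ?_ hrank
    rw [schmidtRank, schmidtRank, map_smul]
    refine Submodule.finrank_mono ?_
    rintro _ ⟨x, rfl⟩
    exact ⟨((sNorm k v)⁻¹ : ℂ) • x, by simp⟩
  · have h4 : inner ℂ (((sNorm k v)⁻¹ : ℂ) • w) v =
        (starRingEnd ℂ) ((sNorm k v)⁻¹ : ℂ) * inner ℂ w v := by
      rw [inner_eq_sum_toOp e, inner_eq_sum_toOp e, Finset.mul_sum]
      refine Finset.sum_congr rfl fun i _ => ?_
      rw [map_smul, LinearMap.smul_apply, inner_smul_left]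
    rw [h4, hwv, norm_mul, RCLike.norm_conj, norm_inv, Complex.norm_real,
      Complex.norm_real, norm_pow, Real.norm_of_nonneg h0]
    field_simp

/-- `U` is a unitary of the form `W ⊗ Y` or, when `m = n`, `S (W ⊗ Y)`, with `W` and `Y` unitary. -/
def IsLocalUnitary {m n : ℕ} (U : (H m ⊗[ℂ] H n) →ₗ[ℂ] (H m ⊗[ℂ] H n)) : Prop :=
  U ∈ unitary ((H m ⊗[ℂ] H n) →ₗ[ℂ] (H m ⊗[ℂ] H n)) ∧
    ∃ W ∈ unitary (H m →ₗ[ℂ] H m), ∃ Y ∈ unitary (H n →ₗ[ℂ] H n),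
      U = TensorProduct.map W Y ∨ ∃ h : m = n, U = swapOp h ∘ₗ TensorProduct.map W Y

end SchmidtNorm

end

/-! By `sNorm_eq_sSup`, the norm is the support function of the set of unit vectors of Schmidt rank
at most `k`, so an isometry should have an adjoint that preserves this set. An isometry `U` is
injective, hence invertible. For `w` in the set, `U⁻¹ w` has norm 1, and the supremum is attained at
some `e` in the set with `⟨e, U⁻¹ w⟩ = 1`. The vector `x = (U⁻¹)* e` has Hilbert norm at most 1 and
`⟨x, w⟩ = 1`, so `x = w` and `U* w = e` (`adjoint_preserves_unit`).

Thus `U*` and its inverse preserve Schmidt rank at most `k`. Pure tensors can be recognised from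
this rank condition alone: along a line in a pure direction, two consecutive points of rank at most
`k` force the whole line to have it, and every other direction of rank at most `k` admits a
counterexample (`schmidtRank_add_tmul`, `exists_eq_tmul_of_schmidtRank_add`). So `U*` maps pure
tensors to pure tensors, with their norms.

Such an operator is `W ⊗ Y` up to a swap (`isLocalUnitary_of_mapsPure`): a linear family of pure
tensors has a common left or right factor, and the side is the same for all `a ⊗ F`. Passing back to
`U` is then easy. Conversely, a local unitary permutes the set over which the supremum is taken. -/

open scoped TensorProduct

noncomputable section

namespace SchmidtNorm

/-! ### Linear preservers of pure tensors over a field -/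

section Pure

variable {K E F V : Type*} [Field K] [AddCommGroup E] [Module K E] [AddCommGroup F] [Module K F]
  [AddCommGroup V] [Module K V]

/-- Contraction of the left factor with a functional. -/
def contractLeft (φ : E →ₗ[K] K) : E ⊗[K] F →ₗ[K] F :=
  (TensorProduct.lid K F).toLinearMap ∘ₗ φ.rTensor F

/-- Contraction of the right factor with a functional. -/
def contractRight (φ : F →ₗ[K] K) : E ⊗[K] F →ₗ[K] E :=
  (TensorProduct.rid K E).toLinearMap ∘ₗ φ.lTensor E

@[simp] theorem contractLeft_tmul (φ : E →ₗ[K] K) (x : E) (y : F) :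
    contractLeft φ (x ⊗ₜ[K] y) = φ x • y := by simp [contractLeft]

@[simp] theorem contractRight_tmul (φ : F →ₗ[K] K) (x : E) (y : F) :
    contractRight φ (x ⊗ₜ[K] y) = φ y • x := by simp [contractRight]

theorem exists_functional_eq_one {x : E} (hx : x ≠ 0) : ∃ φ : E →ₗ[K] K, φ x = 1 := by
  obtain ⟨f, hf, -⟩ := Submodule.exists_le_ker_of_notMem (K := K) (p := ⊥) (v := x) (by simpa)
  exact ⟨(f x)⁻¹ • f, by simp [hf]⟩

theorem exists_functional_separating {x y : E} (h : y ∉ Submodule.span K {x}) :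
    ∃ φ : E →ₗ[K] K, φ y = 1 ∧ φ x = 0 := by
  obtain ⟨f, hf, hle⟩ := Submodule.exists_le_ker_of_notMem h
  have hx : f x = 0 := hle (Submodule.mem_span_singleton_self x)
  exact ⟨(f y)⁻¹ • f, by simp [hf], by simp [hx]⟩

theorem notMem_span_singleton_symm {x y : E} (hx : x ≠ 0) (h : y ∉ Submodule.span K {x}) :
    x ∉ Submodule.span K {y} := by
  rw [Submodule.mem_span_singleton] at h ⊢
  rintro ⟨c, rfl⟩
  have hc : c ≠ 0 := by rintro rfl; simp at hx
  exact h ⟨c⁻¹, by simp [smul_smul, hc]⟩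

theorem tmul_ne_zero {x : E} {y : F} (hx : x ≠ 0) (hy : y ≠ 0) : x ⊗ₜ[K] y ≠ 0 := by
  obtain ⟨φ, hφ⟩ := exists_functional_eq_one (K := K) hx
  intro h
  have := congrArg (contractLeft φ) h
  simp [hφ, hy] at this

theorem ne_zero_of_tmul_ne_zero {x : E} {y : F} (h : x ⊗ₜ[K] y ≠ 0) : x ≠ 0 ∧ y ≠ 0 :=
  ⟨by rintro rfl; simp at h, by rintro rfl; simp at h⟩

theorem mem_span_of_tmul_eq_left {x x' : E} {y y' : F} (h : x ⊗ₜ[K] y = x' ⊗ₜ[K] y')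
    (hy : y ≠ 0) : x ∈ Submodule.span K {x'} := by
  obtain ⟨φ, hφ⟩ := exists_functional_eq_one (K := K) hy
  have := congrArg (contractRight φ) h
  simp only [contractRight_tmul, hφ, one_smul] at this
  exact Submodule.mem_span_singleton.2 ⟨_, this.symm⟩

theorem mem_span_of_tmul_eq_right {x x' : E} {y y' : F} (h : x ⊗ₜ[K] y = x' ⊗ₜ[K] y')
    (hx : x ≠ 0) : y ∈ Submodule.span K {y'} := by
  obtain ⟨φ, hφ⟩ := exists_functional_eq_one (K := K) hx
  have := congrArg (contractLeft φ) h
  simp only [contractLeft_tmul, hφ, one_smul] at this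
  exact Submodule.mem_span_singleton.2 ⟨_, this.symm⟩

/-- If `x` and `x'` are independent, functionals dual to them contract the identity to `y' = φ p •
q` and `y = ψ p • q`, so the right factors are parallel. -/
theorem mem_span_or_mem_span_of_tmul_add_tmul {x x' p : E} {y y' q : F} (hx : x ≠ 0) (hy : y ≠ 0)
    (h : x ⊗ₜ[K] y + x' ⊗ₜ[K] y' = p ⊗ₜ[K] q) :
    x' ∈ Submodule.span K {x} ∨ y' ∈ Submodule.span K {y} := by
  by_contra! hcon
  obtain ⟨h1, h2⟩ := hcon
  obtain ⟨φ, hφ, hφ'⟩ := exists_functional_separating h1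
  obtain ⟨ψ, hψ, hψ'⟩ := exists_functional_separating (notMem_span_singleton_symm hx h1)
  have e1 := congrArg (contractLeft φ) h
  have e2 := congrArg (contractLeft ψ) h
  simp only [map_add, contractLeft_tmul, hφ, hφ', hψ, hψ', one_smul, zero_smul, zero_add,
    add_zero] at e1 e2
  have hψp : ψ p ≠ 0 := by intro h0; simp [h0] at e2; exact hy e2
  refine h2 (Submodule.mem_span_singleton.2 ⟨φ p * (ψ p)⁻¹, ?_⟩)
  rw [e1, e2, smul_smul]
  field_simp

theorem eq_top_or_eq_top_of_forall_mem {p q : Submodule K V} (h : ∀ v, v ∈ p ∨ v ∈ q) :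
    p = ⊤ ∨ q = ⊤ := by
  by_contra! hcon
  obtain ⟨hp, hq⟩ := hcon
  obtain ⟨x, hx⟩ := SetLike.exists_not_mem_of_ne_top p hp rfl
  obtain ⟨y, hy⟩ := SetLike.exists_not_mem_of_ne_top q hq rfl
  have hxq := (h x).resolve_left hx
  have hyp := (h y).resolve_right hy
  rcases h (x + y) with h' | h'
  · exact hx ((p.add_mem_iff_left hyp).1 h')
  · exact hy ((q.add_mem_iff_right hxq).1 h')

/-- A linear family of pure tensors has a common left factor or a common right factor. -/
theorem exists_common_factor (f : V →ₗ[K] E ⊗[K] F) (hf : ∀ v, ∃ x y, f v = x ⊗ₜ[K] y) :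
    (∃ x, ∀ v, ∃ y, f v = x ⊗ₜ[K] y) ∨ ∃ y, ∀ v, ∃ x, f v = x ⊗ₜ[K] y := by
  by_cases h0 : ∀ v, f v = 0
  · exact Or.inl ⟨0, fun v => ⟨0, by simp [h0]⟩⟩
  push Not at h0
  obtain ⟨v₀, hv₀⟩ := h0
  obtain ⟨x₀, y₀, h₀⟩ := hf v₀
  rw [h₀] at hv₀
  obtain ⟨hx₀, hy₀⟩ := ne_zero_of_tmul_ne_zero hv₀
  -- Purity of `f (v₀ + v)` puts `f v` in `x₀ ⊗ F` or `E ⊗ y₀`. The two preimages cover `V`, so one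
  -- of them is all of `V`.
  have key (v : V) : v ∈ (LinearMap.range (TensorProduct.mk K E F x₀)).comap f ∨
      v ∈ (LinearMap.range ((TensorProduct.mk K E F).flip y₀)).comap f := by
    obtain ⟨x, y, hxy⟩ := hf v
    obtain ⟨p, q, hpq⟩ := hf (v₀ + v)
    rw [map_add, h₀, hxy] at hpq
    simp only [Submodule.mem_comap, LinearMap.mem_range, TensorProduct.mk_apply,
      LinearMap.flip_apply, hxy]
    rcases mem_span_or_mem_span_of_tmul_add_tmul hx₀ hy₀ hpq with h | h
    · obtain ⟨c, rfl⟩ := Submodule.mem_span_singleton.1 h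
      exact Or.inl ⟨c • y, by rw [TensorProduct.smul_tmul]⟩
    · obtain ⟨c, rfl⟩ := Submodule.mem_span_singleton.1 h
      exact Or.inr ⟨c • x, by rw [TensorProduct.smul_tmul]⟩
  rcases eq_top_or_eq_top_of_forall_mem key with h | h
  · refine Or.inl ⟨x₀, fun v => ?_⟩
    obtain ⟨y, hy⟩ := (h ▸ Submodule.mem_top :
      v ∈ (LinearMap.range (TensorProduct.mk K E F x₀)).comap f)
    exact ⟨y, hy.symm⟩
  · refine Or.inr ⟨y₀, fun v => ?_⟩
    obtain ⟨y, hy⟩ := (h ▸ Submodule.mem_top :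
      v ∈ (LinearMap.range ((TensorProduct.mk K E F).flip y₀)).comap f)
    exact ⟨y, hy.symm⟩

/-- `T` maps pure tensors to pure tensors. -/
def MapsPure {E' F' : Type*} [AddCommGroup E'] [Module K E'] [AddCommGroup F'] [Module K F']
    (T : E ⊗[K] F →ₗ[K] E' ⊗[K] F') : Prop :=
  ∀ a b, ∃ x y, T (a ⊗ₜ[K] b) = x ⊗ₜ[K] y

theorem injective_mk_left {a : E} (ha : a ≠ 0) : Function.Injective (TensorProduct.mk K E F a) := by
  rw [injective_iff_map_eq_zero]
  intro b hb
  by_contra h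
  exact tmul_ne_zero ha h hb

theorem injective_mk_right {b : F} (hb : b ≠ 0) :
    Function.Injective ((TensorProduct.mk K E F).flip b) := by
  rw [injective_iff_map_eq_zero]
  intro a h
  by_contra ha
  exact tmul_ne_zero ha hb h

theorem not_injective_of_forall_mem_span [FiniteDimensional K F] (hF : 1 < Module.finrank K F)
    (g : F →ₗ[K] V) (z : V) (h : ∀ b, g b ∈ Submodule.span K {z}) : ¬ Function.Injective g := by
  intro hg
  have h1 := LinearMap.finrank_range_of_inj hg
  have h2 : LinearMap.range g ≤ Submodule.span K {z} := by rintro _ ⟨b, rfl⟩; exact h b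
  have h3 := (Submodule.finrank_mono h2).trans (finrank_span_le_card (R := K) ({z} : Set V))
  simp at h3
  omega

variable [FiniteDimensional K F]

/-- The side of the common factor cannot change with `a`. If `a₀` had left factor `x'` and `a` had
right factor `y'`, purity of `T ((a + a₀) ⊗ b)` would put `T (a₀ ⊗ b)` or `T (a ⊗ b)` on the line of
`x' ⊗ y'`. One alternative would hold for every `b`, against injectivity, as `dim F > 1`. -/
theorem exists_left_factor_of_exists_left_factor (hF : 1 < Module.finrank K F)
    {E' F' : Type*} [AddCommGroup E'] [Module K E'] [AddCommGroup F'] [Module K F']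
    {T : E ⊗[K] F →ₗ[K] E' ⊗[K] F'} (hT : Function.Injective T) (hp : MapsPure T) {a₀ : E} (ha₀ : a₀ ≠ 0)
    (h₀ : ∃ x, ∀ b, ∃ y, T (a₀ ⊗ₜ[K] b) = x ⊗ₜ[K] y) (a : E) :
    ∃ x, ∀ b, ∃ y, T (a ⊗ₜ[K] b) = x ⊗ₜ[K] y := by
  rcases exists_common_factor (T ∘ₗ TensorProduct.mk K E F a) (fun b => hp a b) with h | h
  · exact h
  obtain ⟨y', hy'⟩ := h
  simp only [LinearMap.comp_apply, TensorProduct.mk_apply] at hy'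
  by_cases ha : a = 0
  · subst ha
    exact ⟨0, fun b => ⟨0, by simp⟩⟩
  exfalso
  obtain ⟨x', hx'⟩ := h₀
  have key (b : F) :
      b ∈ (Submodule.span K {x' ⊗ₜ[K] y'}).comap (T ∘ₗ TensorProduct.mk K E F a₀) ∨
      b ∈ (Submodule.span K {x' ⊗ₜ[K] y'}).comap (T ∘ₗ TensorProduct.mk K E F a) := by
    by_cases hb : b = 0
    · subst hb; left; simp
    obtain ⟨y, hy⟩ := hx' b
    obtain ⟨x, hx⟩ := hy' b
    have n1 : x' ⊗ₜ[K] y ≠ 0 := by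
      rw [← hy, Ne, map_eq_zero_iff T hT]; exact tmul_ne_zero ha₀ hb
    have n2 : x ⊗ₜ[K] y' ≠ 0 := by
      rw [← hx, Ne, map_eq_zero_iff T hT]; exact tmul_ne_zero ha hb
    obtain ⟨p, q, hpq⟩ := hp (a + a₀) b
    rw [TensorProduct.add_tmul, map_add, hx, hy] at hpq
    simp only [Submodule.mem_comap, LinearMap.comp_apply, TensorProduct.mk_apply, hx, hy]
    rcases mem_span_or_mem_span_of_tmul_add_tmul (ne_zero_of_tmul_ne_zero n2).1
      (ne_zero_of_tmul_ne_zero n2).2 hpq with h | h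
    · right
      by_contra hcon
      refine notMem_span_singleton_symm (ne_zero_of_tmul_ne_zero n1).1 ?_ h
      intro hmem
      obtain ⟨c, rfl⟩ := Submodule.mem_span_singleton.1 hmem
      exact hcon (Submodule.mem_span_singleton.2 ⟨c, by simp [TensorProduct.smul_tmul']⟩)
    · left
      obtain ⟨c, rfl⟩ := Submodule.mem_span_singleton.1 h
      exact Submodule.mem_span_singleton.2 ⟨c, by simp⟩
  have inj {a : E} (ha : a ≠ 0) : Function.Injective (T ∘ₗ TensorProduct.mk K E F a) :=
    hT.comp (injective_mk_left ha)
  rcases eq_top_or_eq_top_of_forall_mem key with h | h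
  · exact not_injective_of_forall_mem_span hF _ _ (fun b => Submodule.mem_comap.1 (by rw [h]; trivial))
      (inj ha₀)
  · exact not_injective_of_forall_mem_span hF _ _ (fun b => Submodule.mem_comap.1 (by rw [h]; trivial))
      (inj ha)

variable [FiniteDimensional K E]

/-- A common left factor `x` of all `T (a ⊗ b)`, with this one `b ≠ 0`, would be the left factor of
every `T (a ⊗ b')`. The range of `T` would lie in `x ⊗ F`, too small for an injective `T`. -/
theorem exists_right_factor_of_forall_exists_left_factor (hE : 1 < Module.finrank K E)
    (hF : 1 < Module.finrank K F)
    {T : E ⊗[K] F →ₗ[K] E ⊗[K] F} (hT : Function.Injective T) (hp : MapsPure T)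
    (h : ∀ a, ∃ x, ∀ b, ∃ y, T (a ⊗ₜ[K] b) = x ⊗ₜ[K] y) (b : F) :
    ∃ y, ∀ a, ∃ x, T (a ⊗ₜ[K] b) = x ⊗ₜ[K] y := by
  rcases exists_common_factor (T ∘ₗ (TensorProduct.mk K E F).flip b) (fun a => hp a b) with h' | h'
  swap
  · exact h'
  by_cases hb : b = 0
  · subst hb
    exact ⟨0, fun b => ⟨0, by simp⟩⟩
  exfalso
  obtain ⟨x, hx⟩ := h'
  simp only [LinearMap.comp_apply, LinearMap.flip_apply, TensorProduct.mk_apply] at hx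
  have hr : LinearMap.range T ≤ LinearMap.range (TensorProduct.mk K E F x) := by
    rw [LinearMap.range_eq_map, Submodule.map_le_iff_le_comap, ← TensorProduct.span_tmul_eq_top,
      Submodule.span_le]
    rintro _ ⟨a, b', rfl⟩
    simp only [Submodule.comap_coe, Set.mem_preimage, SetLike.mem_coe, LinearMap.mem_range,
      TensorProduct.mk_apply]
    by_cases ha : a = 0
    · subst ha; exact ⟨0, by simp⟩
    obtain ⟨z, hz⟩ := h a
    obtain ⟨w, hw⟩ := hz b
    obtain ⟨w', hw'⟩ := hz b'
    obtain ⟨y, hy⟩ := hx a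
    have n1 : z ⊗ₜ[K] w ≠ 0 := by
      rw [← hw, Ne, map_eq_zero_iff T hT]; exact tmul_ne_zero ha hb
    obtain ⟨c, rfl⟩ := Submodule.mem_span_singleton.1
      (mem_span_of_tmul_eq_left (hw.symm.trans hy) (ne_zero_of_tmul_ne_zero n1).2)
    exact ⟨c • w', by rw [hw', TensorProduct.smul_tmul]⟩
  have h1 := (Submodule.finrank_mono hr).trans
    (LinearMap.finrank_range_le (TensorProduct.mk K E F x))
  rw [LinearMap.finrank_range_of_inj hT, Module.finrank_tensorProduct] at h1
  nlinarith

/-- An injective preserver of pure tensors that respects left factors is a product. -/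
theorem exists_eq_map_of_exists_left_factor (hE : 1 < Module.finrank K E)
    (hF : 1 < Module.finrank K F)
    {T : E ⊗[K] F →ₗ[K] E ⊗[K] F} (hT : Function.Injective T) (hp : MapsPure T)
    {a₀ : E} (ha₀ : a₀ ≠ 0) (h₀ : ∃ x, ∀ b, ∃ y, T (a₀ ⊗ₜ[K] b) = x ⊗ₜ[K] y) :
    ∃ (W : E →ₗ[K] E) (Y : F →ₗ[K] F), T = TensorProduct.map W Y := by
  have hl := exists_left_factor_of_exists_left_factor hF hT hp ha₀ h₀
  have hr := exists_right_factor_of_forall_exists_left_factor hE hF hT hp hl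
  have : Nontrivial F := Module.nontrivial_of_finrank_pos (by omega : 0 < Module.finrank K F)
  obtain ⟨b₀, hb₀⟩ := exists_ne (0 : F)
  have hne {a : E} {b : F} (ha : a ≠ 0) (hb : b ≠ 0) : T (a ⊗ₜ[K] b) ≠ 0 := by
    rw [Ne, map_eq_zero_iff T hT]; exact tmul_ne_zero ha hb
  obtain ⟨y₀, hy₀⟩ := hr b₀
  have hy₀0 : y₀ ≠ 0 := by
    obtain ⟨x, hx⟩ := hy₀ a₀
    exact (ne_zero_of_tmul_ne_zero (hx ▸ hne ha₀ hb₀)).2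
  obtain ⟨ψ, hψ⟩ := exists_functional_eq_one (K := K) hy₀0
  -- Since `ψ y₀ = 1`, contraction reads off the left factor exactly; likewise `φ (W a₀) = 1` fixes
  -- the scale of `Y` below.
  let W : E →ₗ[K] E := contractRight ψ ∘ₗ T ∘ₗ (TensorProduct.mk K E F).flip b₀
  have hW (a : E) : T (a ⊗ₜ[K] b₀) = W a ⊗ₜ[K] y₀ := by
    obtain ⟨x, hx⟩ := hy₀ a
    simp [W, hx, hψ]
  have hW0 {a : E} (ha : a ≠ 0) : W a ≠ 0 :=
    (ne_zero_of_tmul_ne_zero (hW a ▸ hne ha hb₀)).1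
  have hWl (a : E) (b : F) : ∃ y, T (a ⊗ₜ[K] b) = W a ⊗ₜ[K] y := by
    by_cases ha : a = 0
    · subst ha; exact ⟨0, by simp⟩
    obtain ⟨x, hx⟩ := hl a
    obtain ⟨y, hy⟩ := hx b
    obtain ⟨y', hy'⟩ := hx b₀
    have n : x ⊗ₜ[K] y' ≠ 0 := hy' ▸ hne ha hb₀
    obtain ⟨c, rfl⟩ := Submodule.mem_span_singleton.1 (mem_span_of_tmul_eq_left
      (hy'.symm.trans (hW a)) (ne_zero_of_tmul_ne_zero n).2)
    exact ⟨c • y, by rw [hy, TensorProduct.smul_tmul]⟩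
  obtain ⟨φ, hφ⟩ := exists_functional_eq_one (K := K) (hW0 ha₀)
  let Y : F →ₗ[K] F := contractLeft φ ∘ₗ T ∘ₗ TensorProduct.mk K E F a₀
  have hY (b : F) : T (a₀ ⊗ₜ[K] b) = W a₀ ⊗ₜ[K] Y b := by
    obtain ⟨x, hx⟩ := hWl a₀ b
    simp [Y, hx, hφ]
  have hY0 {b : F} (hb : b ≠ 0) : Y b ≠ 0 :=
    (ne_zero_of_tmul_ne_zero (hY b ▸ hne ha₀ hb)).2
  -- The left factor comes from `a` and the right factor from `b`; only a scalar, possibly depending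
  -- on both, remains.
  have hc (a : E) (b : F) : ∃ c : K, T (a ⊗ₜ[K] b) = c • (W a ⊗ₜ[K] Y b) := by
    by_cases ha : a = 0
    · subst ha; exact ⟨0, by simp⟩
    by_cases hb : b = 0
    · subst hb; exact ⟨0, by simp⟩
    obtain ⟨y, hy⟩ := hWl a b
    obtain ⟨z, hz⟩ := hr b
    obtain ⟨x, hx⟩ := hz a
    obtain ⟨x', hx'⟩ := hz a₀
    have hYb : Y b ∈ Submodule.span K {z} :=
      mem_span_of_tmul_eq_right ((hY b).symm.trans hx') (hW0 ha₀)
    have hyz : y ∈ Submodule.span K {z} := mem_span_of_tmul_eq_right (hy.symm.trans hx) (hW0 ha)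
    obtain ⟨c, hc⟩ := Submodule.mem_span_singleton.1 hYb
    obtain ⟨d, hd⟩ := Submodule.mem_span_singleton.1 hyz
    have hc0 : c ≠ 0 := by rintro rfl; exact hY0 hb (by simpa using hc.symm)
    refine ⟨d * c⁻¹, ?_⟩
    rw [hy, ← hc, ← hd, TensorProduct.tmul_smul, TensorProduct.tmul_smul, smul_smul]
    congr 1
    field_simp
  refine ⟨W, Y, TensorProduct.ext' fun a b => ?_⟩
  rw [TensorProduct.map_tmul]
  by_cases hb : b = 0
  · subst hb; simp
  by_cases ha : a ∈ Submodule.span K {a₀}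
  · obtain ⟨s, rfl⟩ := Submodule.mem_span_singleton.1 ha
    rw [← TensorProduct.smul_tmul', map_smul, hY, map_smul, TensorProduct.smul_tmul']
  -- The scalar at `a₀` is 1. Comparing `a` with `a + a₀`, and using that `W` kills no nonzero
  -- vector, independence of `a` and `a₀` gives `c = c' = 1`.
  obtain ⟨c, h1⟩ := hc a b
  obtain ⟨c', h2⟩ := hc (a + a₀) b
  rw [TensorProduct.add_tmul, map_add, h1, hY, map_add] at h2
  have h3 : W ((c - c') • a + (1 - c') • a₀) ⊗ₜ[K] Y b = 0 := by
    rw [TensorProduct.add_tmul] at h2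
    rw [map_add, map_smul, map_smul, TensorProduct.add_tmul, ← TensorProduct.smul_tmul',
      ← TensorProduct.smul_tmul', ← sub_eq_zero.2 h2]
    module
  have h4 : (c - c') • a + (1 - c') • a₀ = 0 := by
    by_contra h
    exact tmul_ne_zero (hW0 h) (hY0 hb) h3
  have h5 : c - c' = 0 := by
    by_contra h
    refine ha (Submodule.mem_span_singleton.2 ⟨-(c - c')⁻¹ * (1 - c'), ?_⟩)
    have h6 : a = (c - c')⁻¹ • ((c - c') • a) := by rw [smul_smul, inv_mul_cancel₀ h, one_smul]
    rw [eq_neg_of_add_eq_zero_left h4] at h6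
    rw [h6, neg_mul, neg_smul, smul_neg, smul_smul]
  rw [h5, zero_smul, zero_add, smul_eq_zero, or_iff_left ha₀] at h4
  rw [h1, show c = 1 by linear_combination h5 - h4, one_smul]

end Pure

/-! ### Schmidt decomposition, Schmidt rank, and a rank test for pure tensors -/

section Schmidt

variable {m n : ℕ}

/-- Coordinatewise complex conjugation. -/
def conjVec (x : H n) : H n := WithLp.toLp 2 (star x.ofLp)

@[simp] theorem conjVec_conjVec (x : H n) : conjVec (conjVec x) = x := by
  ext i; simp [conjVec]

theorem sum_mul_eq_inner_conjVec (b x : H n) : ∑ j, b j * x j = inner ℂ (conjVec b) x := by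
  simp [conjVec, PiLp.inner_apply, mul_comm]

theorem inner_conjVec_conjVec (x y : H n) : inner ℂ (conjVec x) (conjVec y) = inner ℂ y x := by
  simp [conjVec, PiLp.inner_apply, mul_comm]

theorem toOp_tmul_conjVec (a : H m) (b x : H n) :
    toOp m n (a ⊗ₜ[ℂ] b) x = inner ℂ (conjVec b) x • a := by
  rw [toOp_tmul_apply, sum_mul_eq_inner_conjVec]

theorem toOp_injective : Function.Injective (toOp m n) := by
  rw [injective_iff_map_eq_zero]
  intro v hv
  have h := inner_eq_sum_toOp (EuclideanSpace.basisFun (Fin n) ℂ) v v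
  refine (inner_self_eq_zero (𝕜 := ℂ)).1 ?_
  rw [h]
  simp [hv]

theorem orthonormal_tmul {ι : Type*} {a : ι → H m} {b : ι → H n} (ha : Orthonormal ℂ a)
    (hb : Orthonormal ℂ b) : Orthonormal ℂ fun i => a i ⊗ₜ[ℂ] b i := by
  classical
  rw [orthonormal_iff_ite] at ha hb ⊢
  intro i j
  rw [TensorProduct.inner_tmul, ha, hb]
  split_ifs <;> simp

/-- The Schmidt decomposition. -/
theorem exists_schmidt_decomposition (v : H m ⊗[ℂ] H n) :
    ∃ (a : Fin (min m n) → H m) (b : Fin (min m n) → H n), Orthonormal ℂ a ∧ Orthonormal ℂ b ∧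
      v = ∑ i : Fin (min m n), (schmidtCoeff v i : ℂ) • a i ⊗ₜ[ℂ] b i := by
  set A := toOp m n v with hA
  obtain ⟨e, he⟩ := exists_singular_basis A
  -- The left singular vectors. They are orthonormal only on `s`, where the singular value is
  -- nonzero; the other values are placeholders, replaced when `u` on `s` is extended to a basis
  -- `f`.
  let u : Fin m → H m := fun i =>
    if h : i.val < n then ((A.singularValues i : ℂ)⁻¹) • A (e ⟨i, h⟩) else 0
  let s : Set (Fin m) := {i | i.val < n ∧ A.singularValues i ≠ 0}
  have hu : Orthonormal ℂ (s.domRestrict u) := by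
    rw [orthonormal_iff_ite]
    rintro ⟨i, hi, hi0⟩ ⟨j, hj, hj0⟩
    simp only [Set.domRestrict_apply, u, hi, hj, dif_pos, inner_smul_left, inner_smul_right, he,
      Subtype.mk.injEq, Fin.ext_iff]
    split_ifs with hij
    · rw [hij] at hi0 ⊢
      have : (A.singularValues j : ℂ) ≠ 0 := by exact_mod_cast hj0
      simp only [map_inv₀, Complex.conj_ofReal]
      push_cast
      field_simp
    · simp
  obtain ⟨f, hf⟩ := hu.exists_orthonormalBasis_extension_of_card_eq (by simp)
  have hnorm (i : Fin n) : A.singularValues i = 0 → A (e i) = 0 := by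
    intro h
    have := he i i
    simpa [h] using this
  have hbig (i : Fin n) (hi : ¬ i.val < m) : A.singularValues i = 0 := by
    rw [LinearMap.singularValues_eq_zero_iff_le_finrank_range]
    refine (Submodule.finrank_le _).trans ?_
    simpa using not_lt.1 hi
  have hAe (i : Fin n) (hi : i.val < m) :
      A (e i) = (A.singularValues i : ℂ) • f ⟨i, hi⟩ := by
    by_cases h0 : A.singularValues i = 0
    · simp [h0, hnorm i h0]
    · have : (A.singularValues i : ℂ) ≠ 0 := by exact_mod_cast h0
      rw [hf ⟨i, hi⟩ ⟨i.2, h0⟩]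
      simp [u, smul_smul, this]
  refine ⟨fun i => f (i.castLE (min_le_left m n)),
    -- The conjugate appears because `toOp` is linear in `b`: the operator of `a ⊗ b` pairs its
    -- argument with `conjVec b`.
    fun i => conjVec (e (i.castLE (min_le_right m n))),
    f.orthonormal.comp _ (Fin.castLE_injective _), ?_, toOp_injective ?_⟩
  · rw [orthonormal_iff_ite]
    intro i j
    rw [inner_conjVec_conjVec, orthonormal_iff_ite.1 e.orthonormal]
    simp [Fin.ext_iff, eq_comm]
  · refine e.toBasis.ext fun j => ?_
    simp only [OrthonormalBasis.coe_toBasis, map_sum, map_smul, LinearMap.sum_apply,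
      LinearMap.smul_apply, toOp_tmul_conjVec, conjVec_conjVec, OrthonormalBasis.inner_eq_ite]
    rw [← hA]
    by_cases hj : j.val < m
    · rw [Finset.sum_eq_single ⟨j, lt_min hj j.2⟩, hAe j hj]
      · simp [schmidtCoeff, hA]
      · intro i _ hij
        rw [if_neg, zero_smul, smul_zero]
        intro h
        exact hij (Fin.ext (by simpa [Fin.ext_iff] using h))
      · simp
    · rw [hnorm j (hbig j hj), Finset.sum_eq_zero]
      intro i _
      rw [if_neg, zero_smul, smul_zero]
      intro h
      have : i.val = j.val := by simpa [Fin.ext_iff] using h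
      have := i.2
      omega

theorem schmidtRank_le_of_eq_sum {ι : Type*} (s : Finset ι) (a : ι → H m) (b : ι → H n) :
    schmidtRank (∑ i ∈ s, a i ⊗ₜ[ℂ] b i) ≤ s.card := by
  classical
  have hsub : LinearMap.range (toOp m n (∑ i ∈ s, a i ⊗ₜ[ℂ] b i)) ≤
      Submodule.span ℂ ((s.image a : Finset (H m)) : Set (H m)) := by
    rintro _ ⟨x, rfl⟩
    simp only [map_sum, LinearMap.sum_apply, toOp_tmul_conjVec]
    exact Submodule.sum_mem _ fun i hi => Submodule.smul_mem _ _
      (Submodule.subset_span (Finset.mem_coe.2 (Finset.mem_image_of_mem _ hi)))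
  exact (Submodule.finrank_mono hsub).trans
    ((finrank_span_finset_le_card _).trans Finset.card_image_le)

theorem schmidtCoeff_eq_zero {k i : ℕ} {v : H m ⊗[ℂ] H n} (hv : schmidtRank v ≤ k) (hi : k ≤ i) :
    schmidtCoeff v i = 0 :=
  (LinearMap.singularValues_eq_zero_iff_le_finrank_range _).2 (hv.trans hi)

theorem schmidtRank_le_iff_exists_sum {k : ℕ} (v : H m ⊗[ℂ] H n) :
    schmidtRank v ≤ k ↔ ∃ (a : Fin k → H m) (b : Fin k → H n), v = ∑ i, a i ⊗ₜ[ℂ] b i := by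
  refine ⟨fun h => ?_, ?_⟩
  · obtain ⟨a, b, -, -, hv⟩ := exists_schmidt_decomposition v
    refine ⟨fun i => if hi : i.val < min m n then (schmidtCoeff v i : ℂ) • a ⟨i, hi⟩ else 0,
      fun i => if hi : i.val < min m n then b ⟨i, hi⟩ else 0, ?_⟩
    -- The decomposition has `min m n` terms, not `k`. Indexing by `ℕ` with zero terms allows both
    -- lengths to be compared inside a longer range.
    let g : ℕ → H m ⊗[ℂ] H n := fun i =>
      if hi : i < min m n then (schmidtCoeff v i : ℂ) • a ⟨i, hi⟩ ⊗ₜ[ℂ] b ⟨i, hi⟩ else 0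
    have h1 : v = ∑ i ∈ Finset.range (min m n), g i := by
      rw [← Fin.sum_univ_eq_sum_range]
      conv_lhs => rw [hv]
      exact Finset.sum_congr rfl fun i _ => by simp only [g, dif_pos i.2]
    have h2 : ∀ i, k ≤ i → g i = 0 := by
      intro i hi
      simp only [g, schmidtCoeff_eq_zero h hi, Complex.ofReal_zero, zero_smul, dite_eq_ite, ite_self]
    have h3 : ∀ i, min m n ≤ i → g i = 0 := fun i hi => dif_neg (not_lt.2 hi)
    refine h1.trans ?_
    trans ∑ i ∈ Finset.range (max k (min m n)), g i
    · refine Finset.sum_subset (Finset.range_subset_range.2 (le_max_right _ _)) fun i _ hi => h3 i ?_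
      exact not_lt.1 fun h' => hi (Finset.mem_range.2 h')
    trans ∑ i ∈ Finset.range k, g i
    · refine (Finset.sum_subset (Finset.range_subset_range.2 (le_max_left _ _))
        fun i _ hi => h2 i ?_).symm
      simpa using hi
    rw [← Fin.sum_univ_eq_sum_range]
    refine Finset.sum_congr rfl fun i _ => ?_
    by_cases hi : i.val < min m n
    · simp only [g, dif_pos hi, TensorProduct.smul_tmul']
    · simp only [g, dif_neg hi, TensorProduct.zero_tmul]
  · rintro ⟨a, b, rfl⟩
    simpa using schmidtRank_le_of_eq_sum Finset.univ a b

/-- Otherwise the range contains the `k + 1` orthonormal vectors `a 0, …, a k`. -/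
theorem exists_eq_zero_of_schmidtRank_le {K k : ℕ} (hk : k < K) {a : Fin K → H m}
    {b : Fin K → H n} (ha : Orthonormal ℂ a) (hb : Orthonormal ℂ b) (c : Fin K → ℂ)
    (h : schmidtRank (∑ i, c i • a i ⊗ₜ[ℂ] b i) ≤ k) : ∃ i, i.val ≤ k ∧ c i = 0 := by
  by_contra! hc
  have hmem (i : Fin K) (hi : i.val ≤ k) :
      a i ∈ LinearMap.range (toOp m n (∑ i, c i • a i ⊗ₜ[ℂ] b i)) := by
    refine ⟨(c i)⁻¹ • conjVec (b i), ?_⟩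
    simp only [map_smul, map_sum, LinearMap.sum_apply, LinearMap.smul_apply, toOp_tmul_conjVec,
      inner_conjVec_conjVec, orthonormal_iff_ite.1 hb]
    rw [Finset.sum_eq_single i]
    · simp [smul_smul, hc i hi]
    · intro j _ hj
      simp [hj.symm]
    · simp
  have hli := (ha.comp _ (Fin.castLE_injective (Nat.succ_le_of_lt hk))).linearIndependent
  have hcard := finrank_span_eq_card hli
  have hle := Submodule.finrank_mono (Submodule.span_le.2
    (by rintro _ ⟨i, rfl⟩; exact hmem _ (Nat.lt_succ_iff.1 i.2) :
      Set.range (a ∘ Fin.castLE (Nat.succ_le_of_lt hk)) ⊆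
        LinearMap.range (toOp m n (∑ i, c i • a i ⊗ₜ[ℂ] b i))))
  rw [hcard, Fintype.card_fin] at hle
  exact absurd (hle.trans h) (by simp)

/-- The operators are `f + t φ(·) a`. If `a` lies in the range of `f`, ranges do not grow; if `φ`
vanishes on `ker f`, kernels do not shrink. Otherwise some `x₀` in `ker f` gives `a` in the range at
`t = 1`, which then contains the range at every `t`. -/
theorem schmidtRank_add_tmul {k : ℕ} {w : H m ⊗[ℂ] H n} {a : H m} {b : H n}
    (hw : schmidtRank w ≤ k) (h1 : schmidtRank (w + a ⊗ₜ[ℂ] b) ≤ k) (t : ℂ) :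
    schmidtRank (w + t • a ⊗ₜ[ℂ] b) ≤ k := by
  set f := toOp m n w with hf
  set φ : H n → ℂ := fun x => inner ℂ (conjVec b) x with hφ
  have hft (x : H n) : toOp m n (w + t • a ⊗ₜ[ℂ] b) x = f x + (t * φ x) • a := by
    simp [toOp_tmul_conjVec, hφ, smul_smul, hf]
  have hf1 (x : H n) : toOp m n (w + a ⊗ₜ[ℂ] b) x = f x + φ x • a := by
    simp [toOp_tmul_conjVec, hφ, hf]
  by_cases ha : a ∈ LinearMap.range f
  · refine (Submodule.finrank_mono ?_).trans hw
    rintro _ ⟨x, rfl⟩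
    rw [hft]
    exact Submodule.add_mem _ ⟨x, rfl⟩ (Submodule.smul_mem _ _ ha)
  by_cases hk : ∀ x, f x = 0 → φ x = 0
  · have hker : LinearMap.ker f ≤ LinearMap.ker (toOp m n (w + t • a ⊗ₜ[ℂ] b)) := by
      intro x hx
      rw [LinearMap.mem_ker] at hx ⊢
      rw [hft, hx, hk x hx, mul_zero, zero_smul, add_zero]
    have e1 := LinearMap.finrank_range_add_finrank_ker f
    have e2 := LinearMap.finrank_range_add_finrank_ker (toOp m n (w + t • a ⊗ₜ[ℂ] b))
    have e3 := Submodule.finrank_mono hker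
    rw [schmidtRank, ← hf] at hw
    rw [schmidtRank]
    omega
  push Not at hk
  obtain ⟨x₀, hx₀, hφ₀⟩ := hk
  have ha1 : a ∈ LinearMap.range (toOp m n (w + a ⊗ₜ[ℂ] b)) :=
    ⟨(φ x₀)⁻¹ • x₀, by rw [map_smul, hf1, hx₀, zero_add, smul_smul, inv_mul_cancel₀ hφ₀, one_smul]⟩
  have hlt : LinearMap.range (toOp m n (w + t • a ⊗ₜ[ℂ] b)) ≤
      LinearMap.range (toOp m n (w + a ⊗ₜ[ℂ] b)) := by
    rintro _ ⟨x, rfl⟩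
    rw [hft, show f x + (t * φ x) • a = toOp m n (w + a ⊗ₜ[ℂ] b) x + (t * φ x - φ x) • a by
      rw [hf1]; module]
    exact Submodule.add_mem _ ⟨x, rfl⟩ (Submodule.smul_mem _ _ ha1)
  exact (Submodule.finrank_mono hlt).trans h1

/-- Among the vectors of Schmidt rank at most `k`, the pure tensors are singled out by the
behaviour of the vectors of Schmidt rank at most `k` on lines in their direction. -/
theorem exists_eq_tmul_of_schmidtRank_add {k : ℕ} (hk : 1 ≤ k) (hkmn : k < min m n)
    {v : H m ⊗[ℂ] H n} (hv : schmidtRank v ≤ k)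
    (h : ∀ w, schmidtRank w ≤ k → schmidtRank (w + v) ≤ k → schmidtRank (w + (2 : ℂ) • v) ≤ k) :
    ∃ a b, v = a ⊗ₜ[ℂ] b := by
  obtain ⟨a, b, ha, hb, hsum⟩ := exists_schmidt_decomposition v
  have hrank (c : Fin (min m n) → ℂ) (i₀ : Fin (min m n)) (h₀ : i₀.val ≤ k) (hc₀ : c i₀ = 0)
      (hc : ∀ i, k < i.val → c i = 0) : schmidtRank (∑ i, c i • a i ⊗ₜ[ℂ] b i) ≤ k := by
    have hcard : ((Finset.univ.filter fun i : Fin (min m n) => i.val ≤ k).erase i₀).card ≤ k := by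
      rw [Finset.card_erase_of_mem (by simpa using h₀),
        ← Finset.card_image_of_injective _ Fin.val_injective]
      have : (Finset.image Fin.val
          (Finset.univ.filter fun i : Fin (min m n) => i.val ≤ k)).card ≤
          (Finset.range (k + 1)).card := by
        refine Finset.card_le_card fun j hj => ?_
        simp only [Finset.mem_image, Finset.mem_filter] at hj
        obtain ⟨i, hi, rfl⟩ := hj
        simpa using Nat.lt_succ_of_le hi.2
      rw [Finset.card_range] at this
      omega
    refine le_trans (le_of_eq_of_le ?_ (schmidtRank_le_of_eq_sum
      ((Finset.univ.filter fun i : Fin (min m n) => i.val ≤ k).erase i₀)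
      (fun i => c i • a i) b)) hcard
    congr 1
    simp only [← TensorProduct.smul_tmul']
    refine (Finset.sum_subset (Finset.subset_univ _) fun i _ hi => ?_).symm
    have : c i = 0 := by
      by_cases hii : i = i₀
      · rw [hii, hc₀]
      · exact hc i (by simpa [hii] using hi)
    simp [this]
  let i₀ : Fin (min m n) := ⟨0, by omega⟩
  let i₁ : Fin (min m n) := ⟨1, by omega⟩
  have h01 : i₁ ≠ i₀ := by simp [i₀, i₁]
  by_cases h1 : schmidtCoeff v 1 = 0
  · refine ⟨(schmidtCoeff v 0 : ℂ) • a i₀, b i₀, ?_⟩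
    conv_lhs => rw [hsum]
    rw [Finset.sum_eq_single i₀, ← TensorProduct.smul_tmul']
    · intro i _ hi
      have hi' : 1 ≤ i.val := Nat.one_le_iff_ne_zero.2 fun h => hi (Fin.ext h)
      have : schmidtCoeff v i = 0 := le_antisymm
        (((toOp m n v).singularValues_antitone hi').trans h1.le)
        ((toOp m n v).singularValues_nonneg _)
      simp [this]
    · simp
  exfalso
  have hpos1 : 0 < schmidtCoeff v 1 :=
    lt_of_le_of_ne ((toOp m n v).singularValues_nonneg _) (Ne.symm h1)
  have hpos0 : 0 < schmidtCoeff v 0 :=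
    hpos1.trans_le ((toOp m n v).singularValues_antitone zero_le_one)
  -- The counterexample `w` has coefficients `0, -α₁, 1, …, 1` at the indices `0, …, k`. So `w`
  -- misses index 0 and `w + v` misses index 1, while `w + 2v` has `2α₀, α₁, 1 + 2αᵢ`, all positive:
  -- rank at least `k + 1`.
  let c : Fin (min m n) → ℝ := fun i =>
    if i = i₀ then 0 else if i = i₁ then -schmidtCoeff v 1 else if i.val ≤ k then 1 else 0
  have hs (t : ℝ) : ∑ i, (c i : ℂ) • a i ⊗ₜ[ℂ] b i + (t : ℂ) • v =
      ∑ i, ((c i + t * schmidtCoeff v i : ℝ) : ℂ) • a i ⊗ₜ[ℂ] b i := by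
    conv_lhs => rw [hsum]
    rw [Finset.smul_sum, ← Finset.sum_add_distrib]
    refine Finset.sum_congr rfl fun i _ => ?_
    push_cast
    rw [smul_smul, ← add_smul]
  have hc (i : Fin (min m n)) (hi : k < i.val) : c i = 0 := by
    have h0 : i ≠ i₀ := by rintro rfl; simp [i₀] at hi
    have h1 : i ≠ i₁ := by rintro rfl; simp [i₁] at hi; omega
    simp [c, h0, h1, not_le.2 hi]
  have r0 := hrank (fun i => (c i : ℂ)) i₀ (Nat.zero_le _) (by simp [c])
    (fun i hi => by simp [hc i hi])
  have r1 := hrank (fun i => ((c i + 1 * schmidtCoeff v i : ℝ) : ℂ)) i₁ hk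
    (by simp [c, h01, i₁])
    (fun i hi => by simp [hc i hi, schmidtCoeff_eq_zero hv hi.le])
  have r2 := h _ r0 (by
    have := hs 1
    rw [Complex.ofReal_one, one_smul] at this
    rw [this]
    exact r1)
  have hs2 := hs 2
  rw [Complex.ofReal_ofNat] at hs2
  rw [hs2] at r2
  obtain ⟨i, hi, hi0⟩ := exists_eq_zero_of_schmidtRank_le hkmn ha hb _ r2
  have hi0' : c i + 2 * schmidtCoeff v i = 0 := by exact_mod_cast hi0
  have hnn : 0 ≤ schmidtCoeff v i := (toOp m n v).singularValues_nonneg _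
  by_cases e0 : i = i₀
  · subst e0
    simp [c, i₀] at hi0'
    exact hpos0.ne' hi0'
  by_cases e1 : i = i₁
  · subst e1
    simp only [c, if_neg h01, if_true] at hi0'
    simp only [i₁] at hi0'
    linarith
  · simp only [c, if_neg e0, if_neg e1, if_pos hi] at hi0'
    linarith

end Schmidt

/-! ### From pure-tensor preservers to local unitaries -/

section Structure

theorem mem_unitary_iff_norm_map {V : Type*} [NormedAddCommGroup V] [InnerProductSpace ℂ V]
    [FiniteDimensional ℂ V] (T : V →ₗ[ℂ] V) :
    T ∈ unitary (V →ₗ[ℂ] V) ↔ ∀ x, ‖T x‖ = ‖x‖ := by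
  rw [Unitary.mem_iff, LinearMap.star_eq_adjoint]
  constructor
  · rintro ⟨h, -⟩ x
    have h1 : inner ℂ (T x) (T x) = inner ℂ x x := by
      rw [← LinearMap.adjoint_inner_right, ← Module.End.mul_apply, h, Module.End.one_apply]
    rw [@norm_eq_sqrt_re_inner ℂ, h1, ← @norm_eq_sqrt_re_inner ℂ]
  · intro h
    have h1 : LinearMap.adjoint T * T = 1 := by
      refine LinearMap.ext fun x => ext_inner_left ℂ fun y => ?_
      rw [Module.End.mul_apply, LinearMap.adjoint_inner_right, Module.End.one_apply]
      exact (⟨T, h⟩ : V →ₗᵢ[ℂ] V).inner_map_map y x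
    exact ⟨h1, mul_eq_one_comm.1 h1⟩

theorem exists_eq_map_of_exists_right_factor {K E F : Type*} [Field K] [AddCommGroup E]
    [Module K E] [AddCommGroup F] [Module K F] [FiniteDimensional K E] [FiniteDimensional K F]
    (hE : 1 < Module.finrank K E) (hF : 1 < Module.finrank K F)
    {T : E ⊗[K] F →ₗ[K] E ⊗[K] F} (hT : Function.Injective T) (hp : MapsPure T)
    {b₀ : F} (hb₀ : b₀ ≠ 0) (h₀ : ∃ y, ∀ a, ∃ x, T (a ⊗ₜ[K] b₀) = x ⊗ₜ[K] y) :
    ∃ (W : E →ₗ[K] E) (Y : F →ₗ[K] F), T = TensorProduct.map W Y := by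
  let T' : F ⊗[K] E →ₗ[K] F ⊗[K] E :=
    (TensorProduct.comm K E F).toLinearMap ∘ₗ T ∘ₗ (TensorProduct.comm K F E).toLinearMap
  have hT'a (b : F) (a : E) : T' (b ⊗ₜ a) = TensorProduct.comm K E F (T (a ⊗ₜ b)) := by simp [T']
  obtain ⟨Y, W, h⟩ := exists_eq_map_of_exists_left_factor (T := T') hF hE
    ((TensorProduct.comm K E F).injective.comp (hT.comp (TensorProduct.comm K F E).injective))
    (fun b a => by
      obtain ⟨x, y, h⟩ := hp a b
      exact ⟨y, x, by simp [hT'a, h]⟩) hb₀ (by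
      obtain ⟨y, hy⟩ := h₀
      refine ⟨y, fun a => ?_⟩
      obtain ⟨x, hx⟩ := hy a
      exact ⟨x, by simp [hT'a, hx]⟩)
  refine ⟨W, Y, TensorProduct.ext' fun a b => (TensorProduct.comm K E F).injective ?_⟩
  rw [← hT'a, h]
  simp

variable {m n : ℕ}

theorem swapOp_rfl_eq_comm :
    (swapOp rfl : H n ⊗[ℂ] H n →ₗ[ℂ] H n ⊗[ℂ] H n) = (TensorProduct.comm ℂ (H n) (H n)).toLinearMap :=
  TensorProduct.ext' fun a b => by rw [swapOp_tmul]; simp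

theorem swapOp_swapOp (x : H n ⊗[ℂ] H n) : swapOp rfl (swapOp rfl x) = x := by
  simp [swapOp_rfl_eq_comm]

theorem norm_swapOp (h : m = n) (x : H m ⊗[ℂ] H n) : ‖swapOp h x‖ = ‖x‖ := by
  subst h
  rw [swapOp_rfl_eq_comm]
  simp

theorem norm_map_of_mem_unitary {W : H m →ₗ[ℂ] H m} {Y : H n →ₗ[ℂ] H n}
    (hW : W ∈ unitary (H m →ₗ[ℂ] H m)) (hY : Y ∈ unitary (H n →ₗ[ℂ] H n)) (x : H m ⊗[ℂ] H n) :
    ‖TensorProduct.map W Y x‖ = ‖x‖ :=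
  TensorProduct.norm_map ⟨W, (mem_unitary_iff_norm_map W).1 hW⟩
    ⟨Y, (mem_unitary_iff_norm_map Y).1 hY⟩ x

/-- The factors are determined only up to reciprocal scalars; the factor `‖Y b₀‖` normalises both,
as `‖W a₀‖ ‖Y b₀‖ = 1`. -/
theorem exists_unitary_of_eq_map (hm : 0 < m) (hn : 0 < n) {T : H m ⊗[ℂ] H n →ₗ[ℂ] H m ⊗[ℂ] H n}
    (hnorm : ∀ a b, ‖T (a ⊗ₜ[ℂ] b)‖ = ‖a‖ * ‖b‖)
    (h : ∃ (W : H m →ₗ[ℂ] H m) (Y : H n →ₗ[ℂ] H n), T = TensorProduct.map W Y) :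
    ∃ W ∈ unitary (H m →ₗ[ℂ] H m), ∃ Y ∈ unitary (H n →ₗ[ℂ] H n), T = TensorProduct.map W Y := by
  obtain ⟨W, Y, rfl⟩ := h
  simp only [TensorProduct.map_tmul, TensorProduct.norm_tmul] at hnorm
  let a₀ : H m := EuclideanSpace.single ⟨0, hm⟩ 1
  let b₀ : H n := EuclideanSpace.single ⟨0, hn⟩ 1
  have ha₀ : ‖a₀‖ = 1 := by simp [a₀]
  have hb₀ : ‖b₀‖ = 1 := by simp [b₀]
  have h₀ := hnorm a₀ b₀
  rw [ha₀, hb₀, one_mul] at h₀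
  have hY0 : ‖Y b₀‖ ≠ 0 := right_ne_zero_of_mul (h₀ ▸ one_ne_zero)
  have hY0' : (‖Y b₀‖ : ℂ) ≠ 0 := by exact_mod_cast hY0
  refine ⟨(‖Y b₀‖ : ℂ) • W, ?_, (‖Y b₀‖ : ℂ)⁻¹ • Y, ?_, ?_⟩
  · rw [mem_unitary_iff_norm_map]
    intro a
    rw [LinearMap.smul_apply, norm_smul, Complex.norm_real, norm_norm, mul_comm, hnorm, hb₀, mul_one]
  · rw [mem_unitary_iff_norm_map]
    intro b
    have h1 := hnorm a₀ b
    rw [ha₀, one_mul] at h1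
    rw [LinearMap.smul_apply, norm_smul, norm_inv, Complex.norm_real, norm_norm,
      ← h1, eq_inv_of_mul_eq_one_left h₀]
  · rw [TensorProduct.map_smul_left, TensorProduct.map_smul_right, smul_smul, mul_inv_cancel₀ hY0',
      one_smul]

/-- An injective operator that maps pure tensors to pure tensors of the same norm is a local unitary,
up to a swap. -/
theorem isLocalUnitary_of_mapsPure (hm : 1 < m) (hn : 1 < n)
    {T : H m ⊗[ℂ] H n →ₗ[ℂ] H m ⊗[ℂ] H n} (hT : Function.Injective T) (hp : MapsPure T)
    (hnorm : ∀ a b, ‖T (a ⊗ₜ[ℂ] b)‖ = ‖a‖ * ‖b‖) : IsLocalUnitary T := by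
  have dm : Module.finrank ℂ (H m) = m := by simp
  have dn : Module.finrank ℂ (H n) = n := by simp
  have key : ∃ W ∈ unitary (H m →ₗ[ℂ] H m), ∃ Y ∈ unitary (H n →ₗ[ℂ] H n),
      T = TensorProduct.map W Y ∨ ∃ h : m = n, T = swapOp h ∘ₗ TensorProduct.map W Y := by
    by_cases hprod : ∃ (W : H m →ₗ[ℂ] H m) (Y : H n →ₗ[ℂ] H n), T = TensorProduct.map W Y
    · obtain ⟨W, hW, Y, hY, h⟩ := exists_unitary_of_eq_map (by omega) (by omega) hnorm hprod
      exact ⟨W, hW, Y, hY, Or.inl h⟩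
    have : Nontrivial (H m) := Module.nontrivial_of_finrank_pos (R := ℂ) (by omega)
    have : Nontrivial (H n) := Module.nontrivial_of_finrank_pos (R := ℂ) (by omega)
    obtain ⟨a₀, ha₀⟩ := exists_ne (0 : H m)
    obtain ⟨b₀, hb₀⟩ := exists_ne (0 : H n)
    -- If `T` is not a product, it exchanges the sides: `a₀ ⊗ H n` embeds in `H m ⊗ y` and `H m ⊗
    -- b₀` in `x ⊗ H n`. Hence `m = n`, and composing with the swap restores the sides.
    have hr : ∃ y, ∀ b, ∃ x, T (a₀ ⊗ₜ[ℂ] b) = x ⊗ₜ[ℂ] y :=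
      (exists_common_factor (T ∘ₗ TensorProduct.mk ℂ _ _ a₀) (fun b => hp a₀ b)).resolve_left
        fun h => hprod (exists_eq_map_of_exists_left_factor (by omega) (by omega) hT hp ha₀ h)
    have hl : ∃ x, ∀ a, ∃ y, T (a ⊗ₜ[ℂ] b₀) = x ⊗ₜ[ℂ] y :=
      (exists_common_factor (T ∘ₗ (TensorProduct.mk ℂ _ _).flip b₀) (fun a => hp a b₀)).resolve_right
        fun h => hprod (exists_eq_map_of_exists_right_factor (by omega) (by omega) hT hp hb₀ h)
    have hnm : n ≤ m := by
      obtain ⟨y, hy⟩ := hr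
      have hle : LinearMap.range (T ∘ₗ TensorProduct.mk ℂ _ _ a₀) ≤
          LinearMap.range ((TensorProduct.mk ℂ (H m) (H n)).flip y) := by
        rintro _ ⟨b, rfl⟩
        obtain ⟨x, hx⟩ := hy b
        exact ⟨x, hx.symm⟩
      have := (Submodule.finrank_mono hle).trans (LinearMap.finrank_range_le _)
      have hi : Function.Injective (T ∘ₗ TensorProduct.mk ℂ (H m) (H n) a₀) :=
        hT.comp (injective_mk_left ha₀)
      rwa [LinearMap.finrank_range_of_inj hi, dm, dn] at this
    have hmn : m ≤ n := by
      obtain ⟨x, hx⟩ := hl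
      have hle : LinearMap.range (T ∘ₗ (TensorProduct.mk ℂ _ _).flip b₀) ≤
          LinearMap.range (TensorProduct.mk ℂ (H m) (H n) x) := by
        rintro _ ⟨a, rfl⟩
        obtain ⟨y, hy⟩ := hx a
        exact ⟨y, hy.symm⟩
      have := (Submodule.finrank_mono hle).trans (LinearMap.finrank_range_le _)
      have hi : Function.Injective (T ∘ₗ (TensorProduct.mk ℂ (H m) (H n)).flip b₀) :=
        hT.comp (injective_mk_right hb₀)
      rwa [LinearMap.finrank_range_of_inj hi, dm, dn] at this
    obtain rfl : m = n := le_antisymm hmn hnm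
    have hS : Function.Injective (swapOp rfl ∘ₗ T) :=
      (Function.LeftInverse.injective swapOp_swapOp).comp hT
    obtain ⟨W, hW, Y, hY, h⟩ := exists_unitary_of_eq_map (T := swapOp rfl ∘ₗ T) (by omega) (by omega)
      (fun a b => by rw [LinearMap.comp_apply, norm_swapOp, hnorm])
      (exists_eq_map_of_exists_left_factor (by omega) (by omega) hS
        (fun a b => by
          obtain ⟨x, y, h⟩ := hp a b
          exact ⟨y, x, by rw [LinearMap.comp_apply, h, swapOp_tmul]⟩) ha₀ (by
          obtain ⟨y, hy⟩ := hr
          refine ⟨y, fun b => ?_⟩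
          obtain ⟨x, hx⟩ := hy b
          exact ⟨x, by rw [LinearMap.comp_apply, hx, swapOp_tmul]⟩))
    refine ⟨W, hW, Y, hY, Or.inr ⟨rfl, ?_⟩⟩
    rw [← h]
    exact LinearMap.ext fun x => (swapOp_swapOp _).symm
  obtain ⟨W, hW, Y, hY, h⟩ := key
  refine ⟨(mem_unitary_iff_norm_map T).2 fun x => ?_, W, hW, Y, hY, h⟩
  obtain rfl | ⟨h, rfl⟩ := h
  · exact norm_map_of_mem_unitary hW hY x
  · rw [LinearMap.comp_apply, norm_swapOp, norm_map_of_mem_unitary hW hY]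

theorem IsLocalUnitary.mapsPure {U : H m ⊗[ℂ] H n →ₗ[ℂ] H m ⊗[ℂ] H n} (hU : IsLocalUnitary U) :
    MapsPure U := by
  obtain ⟨-, W, -, Y, -, rfl | ⟨h, rfl⟩⟩ := hU
  · exact fun a b => ⟨W a, Y b, TensorProduct.map_tmul _ _ _ _⟩
  · subst h
    exact fun a b => ⟨Y b, W a, by rw [LinearMap.comp_apply, TensorProduct.map_tmul, swapOp_tmul]⟩

/-- Since `star U` inverts `U`, it is enough to exhibit a pure preimage of each `a ⊗ b`. -/
theorem IsLocalUnitary.mapsPure_star {U : H m ⊗[ℂ] H n →ₗ[ℂ] H m ⊗[ℂ] H n}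
    (hU : IsLocalUnitary U) : MapsPure (star U) := by
  obtain ⟨hU, W, hW, Y, hY, h⟩ := hU
  have hW' (x : H m) : W (star W x) = x := LinearMap.congr_fun (Unitary.mem_iff.1 hW).2 x
  have hY' (x : H n) : Y (star Y x) = x := LinearMap.congr_fun (Unitary.mem_iff.1 hY).2 x
  have hU' (x : H m ⊗[ℂ] H n) : star U (U x) = x := LinearMap.congr_fun (Unitary.mem_iff.1 hU).1 x
  intro a b
  obtain h | ⟨rfl, h⟩ := h
  · refine ⟨star W a, star Y b, ?_⟩
    rw [← hU' (star W a ⊗ₜ star Y b)]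
    congr 1
    rw [h, TensorProduct.map_tmul, hW', hY']
  · refine ⟨star W b, star Y a, ?_⟩
    rw [← hU' (star W b ⊗ₜ star Y a)]
    congr 1
    rw [h, LinearMap.comp_apply, TensorProduct.map_tmul, hW', hY', swapOp_tmul]

end Structure

/-! ### Isometries of the norm and their adjoints -/

section Isometry

variable {m n k : ℕ}

theorem sNorm_sq (v : H m ⊗[ℂ] H n) :
    sNorm k v ^ 2 = ∑ i ∈ Finset.range k, schmidtCoeff v i ^ 2 :=
  Real.sq_sqrt (Finset.sum_nonneg fun _ _ => sq_nonneg _)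

theorem sNorm_nonneg (v : H m ⊗[ℂ] H n) : 0 ≤ sNorm k v := Real.sqrt_nonneg _

theorem inner_schmidt_sum {K : ℕ} {a : Fin K → H m} {b : Fin K → H n} (ha : Orthonormal ℂ a)
    (hb : Orthonormal ℂ b) (c d : Fin K → ℝ) :
    inner ℂ (∑ i, (c i : ℂ) • a i ⊗ₜ[ℂ] b i) (∑ i, (d i : ℂ) • a i ⊗ₜ[ℂ] b i) =
      ((∑ i, c i * d i : ℝ) : ℂ) := by
  rw [(orthonormal_tmul ha hb).inner_sum]
  simp

theorem norm_sq_eq_of_inner_self {x : H m ⊗[ℂ] H n} {r : ℝ} (h : inner ℂ x x = (r : ℂ)) :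
    ‖x‖ ^ 2 = r := by
  have h1 : ((‖x‖ : ℂ)) ^ 2 = r := (inner_self_eq_norm_sq_to_K (𝕜 := ℂ) x).symm.trans h
  exact_mod_cast h1

theorem norm_sq_eq_norm_inner (x : H m ⊗[ℂ] H n) : ‖x‖ ^ 2 = ‖(inner ℂ x x : ℂ)‖ := by
  have h1 : (inner ℂ x x : ℂ) = (‖x‖ : ℂ) ^ 2 := inner_self_eq_norm_sq_to_K (𝕜 := ℂ) x
  rw [h1]
  simp

theorem norm_sq_eq_sum_schmidtCoeff (v : H m ⊗[ℂ] H n) :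
    ‖v‖ ^ 2 = ∑ i ∈ Finset.range (min m n), schmidtCoeff v i ^ 2 := by
  obtain ⟨a, b, ha, hb, hv⟩ := exists_schmidt_decomposition v
  have h := inner_schmidt_sum ha hb (fun i => schmidtCoeff v i) (fun i => schmidtCoeff v i)
  rw [← hv] at h
  rw [← Fin.sum_univ_eq_sum_range (fun i => schmidtCoeff v i ^ 2)]
  simp only [sq (schmidtCoeff v _)]
  exact norm_sq_eq_of_inner_self h

theorem sNorm_le_norm (hk : k ≤ min m n) (v : H m ⊗[ℂ] H n) : sNorm k v ≤ ‖v‖ := by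
  refine (sq_le_sq₀ (sNorm_nonneg v) (norm_nonneg v)).1 ?_
  rw [sNorm_sq, norm_sq_eq_sum_schmidtCoeff]
  exact Finset.sum_le_sum_of_subset_of_nonneg (Finset.range_subset_range.2 hk)
    fun _ _ _ => sq_nonneg _

theorem sNorm_eq_norm (hk : k ≤ min m n) {v : H m ⊗[ℂ] H n} (hv : schmidtRank v ≤ k) :
    sNorm k v = ‖v‖ := by
  refine (sq_eq_sq₀ (sNorm_nonneg v) (norm_nonneg v)).1 ?_
  rw [sNorm_sq, norm_sq_eq_sum_schmidtCoeff]
  refine Finset.sum_subset (Finset.range_subset_range.2 hk) fun i _ hi => ?_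
  rw [schmidtCoeff_eq_zero hv (by simpa using hi), zero_pow two_ne_zero]

theorem eq_zero_of_sNorm_eq_zero (hk : 1 ≤ k) {v : H m ⊗[ℂ] H n} (hv : sNorm k v = 0) : v = 0 := by
  have h := sNorm_sq (k := k) v
  rw [hv, zero_pow two_ne_zero, eq_comm,
    Finset.sum_eq_zero_iff_of_nonneg fun _ _ => sq_nonneg _] at h
  have h0 : schmidtCoeff v 0 = 0 := pow_eq_zero_iff two_ne_zero |>.1 (h 0 (Finset.mem_range.2 hk))
  have hi (i : ℕ) : schmidtCoeff v i = 0 := le_antisymm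
    (((toOp m n v).singularValues_antitone (Nat.zero_le i)).trans h0.le)
    ((toOp m n v).singularValues_nonneg _)
  have hn := norm_sq_eq_sum_schmidtCoeff v
  simpa [hi] using hn

theorem norm_inner_le_sNorm {v w : H m ⊗[ℂ] H n} (hw : ‖w‖ = 1) (hr : schmidtRank w ≤ k) :
    ‖inner ℂ w v‖ ≤ sNorm k v := by
  rw [sNorm_eq_sSup]
  refine le_csSup ⟨‖v‖, ?_⟩ ⟨w, hw, hr, rfl⟩
  rintro _ ⟨w', hw', -, rfl⟩
  simpa [hw'] using norm_inner_le_norm (𝕜 := ℂ) w' v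

/-- The supremum that describes `‖v‖_{s(k)}` is attained. -/
theorem exists_inner_eq_one (hk : k ≤ min m n) {v : H m ⊗[ℂ] H n} (hv : sNorm k v = 1) :
    ∃ w : H m ⊗[ℂ] H n, ‖w‖ = 1 ∧ schmidtRank w ≤ k ∧ inner ℂ w v = 1 := by
  obtain ⟨a, b, ha, hb, hsum⟩ := exists_schmidt_decomposition v
  -- The maximiser is `v` cut to its first `k` Schmidt terms, already a unit vector because `sNorm k
  -- v = 1`.
  let c : Fin (min m n) → ℝ := fun i => if i.val < k then schmidtCoeff v i else 0
  have hc : ∑ i : Fin (min m n), (if i.val < k then schmidtCoeff v i ^ 2 else 0) = 1 := by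
    rw [Fin.sum_univ_eq_sum_range (fun i => if i < k then schmidtCoeff v i ^ 2 else 0),
      ← Finset.sum_filter]
    have : (Finset.range (min m n)).filter (· < k) = Finset.range k := by
      ext i; simp only [Finset.mem_filter, Finset.mem_range]; omega
    rw [this, ← sNorm_sq, hv, one_pow]
  refine ⟨∑ i, (c i : ℂ) • a i ⊗ₜ[ℂ] b i, ?_, ?_, ?_⟩
  · have h := inner_schmidt_sum ha hb c c
    have hcc : ∑ i, c i * c i = 1 := by
      rw [← hc]
      refine Finset.sum_congr rfl fun i _ => ?_
      simp only [c]; split_ifs <;> ring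
    rw [hcc] at h
    exact (pow_eq_one_iff_of_nonneg (norm_nonneg _) two_ne_zero).1 (norm_sq_eq_of_inner_self h)
  · have h1 : ∑ i, (c i : ℂ) • a i ⊗ₜ[ℂ] b i =
        ∑ i ∈ Finset.univ.filter (fun i : Fin (min m n) => i.val < k),
          ((c i : ℂ) • a i) ⊗ₜ[ℂ] b i := by
      simp only [← TensorProduct.smul_tmul']
      refine (Finset.sum_subset (Finset.subset_univ _) fun i _ hi => ?_).symm
      have : ¬ i.val < k := by simpa using hi
      simp [c, this]
    rw [h1]
    refine (schmidtRank_le_of_eq_sum _ _ _).trans ?_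
    rw [← Finset.card_image_of_injective _ Fin.val_injective]
    calc _ ≤ (Finset.range k).card := Finset.card_le_card fun i hi => by
            simp only [Finset.mem_image, Finset.mem_filter] at hi
            obtain ⟨j, hj, rfl⟩ := hi
            simpa using hj.2
      _ = k := Finset.card_range k
  · have h := inner_schmidt_sum ha hb c (fun i => schmidtCoeff v i)
    rw [← hsum] at h
    rw [h]
    have hcc : ∑ i, c i * schmidtCoeff v i = 1 := by
      rw [← hc]
      refine Finset.sum_congr rfl fun i _ => ?_
      simp only [c]; split_ifs <;> ring
    rw [hcc, Complex.ofReal_one]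

theorem schmidtRank_zero_le (k : ℕ) : schmidtRank (0 : H m ⊗[ℂ] H n) ≤ k := by
  rw [schmidtRank, map_zero, LinearMap.range_zero, finrank_bot]
  exact Nat.zero_le k

theorem schmidtRank_smul_le (c : ℂ) (v : H m ⊗[ℂ] H n) : schmidtRank (c • v) ≤ schmidtRank v := by
  rw [schmidtRank, schmidtRank, map_smul]
  refine Submodule.finrank_mono ?_
  rintro _ ⟨x, rfl⟩
  exact ⟨c • x, by simp⟩

theorem adjoint_symm_apply_adjoint {V : Type*} [NormedAddCommGroup V] [InnerProductSpace ℂ V]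
    [FiniteDimensional ℂ V] (U : V ≃ₗ[ℂ] V) (x : V) :
    LinearMap.adjoint U.symm.toLinearMap (LinearMap.adjoint U.toLinearMap x) = x := by
  refine ext_inner_left ℂ fun y => ?_
  simp [LinearMap.adjoint_inner_right]

/-- Equality in Cauchy–Schwarz: `‖x - w‖² = ‖x‖² - 2 + 1 ≤ 0`. -/
theorem eq_of_inner_eq_one {V : Type*} [NormedAddCommGroup V] [InnerProductSpace ℂ V] {x w : V}
    (hx : ‖x‖ ≤ 1) (hw : ‖w‖ = 1) (h : inner ℂ x w = 1) : x = w := by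
  have h1 := norm_sub_sq (𝕜 := ℂ) x w
  rw [h, hw, RCLike.one_re] at h1
  have h2 : ‖x - w‖ ^ 2 ≤ 0 := by nlinarith [norm_nonneg x]
  exact sub_eq_zero.1 (norm_eq_zero.1 (pow_eq_zero_iff two_ne_zero |>.1
    (le_antisymm h2 (sq_nonneg _))))

/-- The adjoint of an isometry of `‖·‖_{s(k)}` preserves the unit vectors of Schmidt rank at
most `k`. -/
theorem adjoint_preserves_unit (hk : k ≤ min m n) (U : (H m ⊗[ℂ] H n) ≃ₗ[ℂ] (H m ⊗[ℂ] H n))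
    (hU : ∀ v, sNorm k (U v) = sNorm k v) {w : H m ⊗[ℂ] H n} (hw : ‖w‖ = 1)
    (hr : schmidtRank w ≤ k) :
    ‖LinearMap.adjoint U.toLinearMap w‖ = 1 ∧
      schmidtRank (LinearMap.adjoint U.toLinearMap w) ≤ k := by
  have hU' (v) : sNorm k (U.symm v) = sNorm k v := by
    conv_rhs => rw [← U.apply_symm_apply v, hU]
  obtain ⟨e, he, her, hev⟩ := exists_inner_eq_one hk (v := U.symm w)
    (by rw [hU', sNorm_eq_norm hk hr, hw])
  set x := LinearMap.adjoint U.symm.toLinearMap e with hx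
  have hadj (y : H m ⊗[ℂ] H n) : inner ℂ x y = inner ℂ e (U.symm y) :=
    LinearMap.adjoint_inner_left U.symm.toLinearMap y e
  have hx1 : ‖x‖ ≤ 1 := by
    -- Testing `x` against itself: `‖x‖² = |⟨e, U⁻¹ x⟩| ≤ sNorm k (U⁻¹ x) = sNorm k x ≤ ‖x‖`.
    have h1 := norm_inner_le_sNorm (v := U.symm x) he her
    rw [← hadj, ← norm_sq_eq_norm_inner, hU'] at h1
    nlinarith [norm_nonneg x, sNorm_le_norm hk x]
  have hxe : x = w := eq_of_inner_eq_one hx1 hw ((hadj w).trans hev)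
  have : LinearMap.adjoint U.toLinearMap w = e := by
    rw [← hxe, hx]
    exact adjoint_symm_apply_adjoint U.symm e
  rw [this]
  exact ⟨he, her⟩

theorem adjoint_preserves (hk : k ≤ min m n) (U : (H m ⊗[ℂ] H n) ≃ₗ[ℂ] (H m ⊗[ℂ] H n))
    (hU : ∀ v, sNorm k (U v) = sNorm k v) {w : H m ⊗[ℂ] H n} (hr : schmidtRank w ≤ k) :
    ‖LinearMap.adjoint U.toLinearMap w‖ = ‖w‖ ∧
      schmidtRank (LinearMap.adjoint U.toLinearMap w) ≤ k := by
  by_cases hw : w = 0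
  · subst hw; simpa using hr
  have hw' : ‖w‖ ≠ 0 := norm_ne_zero_iff.2 hw
  have hwc : (‖w‖ : ℂ) ≠ 0 := by exact_mod_cast hw'
  obtain ⟨h1, h2⟩ := adjoint_preserves_unit hk U hU (w := (‖w‖ : ℂ)⁻¹ • w)
    (by rw [norm_smul, norm_inv, Complex.norm_real, norm_norm, inv_mul_cancel₀ hw'])
    ((schmidtRank_smul_le _ _).trans hr)
  have hs : LinearMap.adjoint U.toLinearMap w =
      (‖w‖ : ℂ) • LinearMap.adjoint U.toLinearMap ((‖w‖ : ℂ)⁻¹ • w) := by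
    rw [map_smul, smul_smul, mul_inv_cancel₀ hwc, one_smul]
  rw [hs]
  exact ⟨by rw [norm_smul, h1, Complex.norm_real, norm_norm, mul_one],
    (schmidtRank_smul_le _ _).trans h2⟩

theorem schmidtRank_tmul_le (a : H m) (b : H n) : schmidtRank (a ⊗ₜ[ℂ] b) ≤ 1 := by
  simpa using schmidtRank_le_of_eq_sum ({()} : Finset Unit) (fun _ => a) (fun _ => b)

/-- An invertible operator that preserves, together with its inverse, the vectors of Schmidt rank at
most `k` maps pure tensors to pure tensors. -/
theorem mapsPure_of_preserves_schmidtRank_le (hk : 1 ≤ k) (hkmn : k < min m n)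
    {T T' : (H m ⊗[ℂ] H n) →ₗ[ℂ] (H m ⊗[ℂ] H n)} (hTT' : ∀ x, T (T' x) = x)
    (hT'T : ∀ x, T' (T x) = x) (hT : ∀ w, schmidtRank w ≤ k → schmidtRank (T w) ≤ k)
    (hT' : ∀ w, schmidtRank w ≤ k → schmidtRank (T' w) ≤ k) : MapsPure T := by
  intro a b
  refine exists_eq_tmul_of_schmidtRank_add hk hkmn
    (hT _ ((schmidtRank_tmul_le a b).trans hk)) fun w hw h => ?_
  -- Pulled back by `T'`, the line through `w` acquires the pure direction `a ⊗ b`, where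
  -- `schmidtRank_add_tmul` applies.
  have h1 := hT' _ h
  rw [map_add, hT'T] at h1
  have h2 := hT _ (schmidtRank_add_tmul (hT' w hw) h1 2)
  rwa [map_add, map_smul, hTT'] at h2

theorem isLocalUnitary_of_sNorm_map (hk : 1 ≤ k) (hkmn : k < min m n)
    (U : (H m ⊗[ℂ] H n) →ₗ[ℂ] (H m ⊗[ℂ] H n)) (hU : ∀ v, sNorm k (U v) = sNorm k v) :
    IsLocalUnitary U := by
  have hm : 1 < m := by omega
  have hn : 1 < n := by omega
  have hinj : Function.Injective U := by
    rw [injective_iff_map_eq_zero]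
    intro v hv
    refine eq_zero_of_sNorm_eq_zero hk ?_
    rw [← hU, hv, sNorm_eq_norm hkmn.le (schmidtRank_zero_le k), norm_zero]
  let u := LinearEquiv.ofInjectiveEndo U hinj
  have hu (v) : u v = U v := rfl
  have hu' (v) : sNorm k (u.symm v) = sNorm k v := by
    rw [← hU, ← hu, u.apply_symm_apply]
  have p1 {w} (hw : schmidtRank w ≤ k) := adjoint_preserves hkmn.le u hU hw
  have p2 {w} (hw : schmidtRank w ≤ k) := adjoint_preserves hkmn.le u.symm hu' hw
  have i1 := adjoint_symm_apply_adjoint u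
  have i2 := adjoint_symm_apply_adjoint u.symm
  rw [LinearEquiv.symm_symm] at i2
  have m1 := mapsPure_of_preserves_schmidtRank_le hk hkmn i2 i1 (fun w hw => (p1 hw).2)
    (fun w hw => (p2 hw).2)
  have hloc : IsLocalUnitary (LinearMap.adjoint u.toLinearMap) :=
    isLocalUnitary_of_mapsPure hm hn (Function.LeftInverse.injective i1) m1 fun a b => by
      rw [(p1 ((schmidtRank_tmul_le a b).trans hk)).1, TensorProduct.norm_tmul]
  have hstar : star (LinearMap.adjoint u.toLinearMap) = U := by
    rw [LinearMap.star_eq_adjoint, LinearMap.adjoint_adjoint]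
    rfl
  -- The operator `U` is the star of a local unitary, hence isometric and pure-preserving; the
  -- structure theorem is applied again, now to `U`.
  have m2 := hloc.mapsPure_star
  have hun := Unitary.star_mem hloc.1
  rw [hstar] at m2 hun
  exact isLocalUnitary_of_mapsPure hm hn hinj m2 fun a b => by
    rw [(mem_unitary_iff_norm_map U).1 hun, TensorProduct.norm_tmul]

theorem MapsPure.schmidtRank_le {T : (H m ⊗[ℂ] H n) →ₗ[ℂ] (H m ⊗[ℂ] H n)} (hT : MapsPure T)
    {w : H m ⊗[ℂ] H n} (hw : schmidtRank w ≤ k) : schmidtRank (T w) ≤ k := by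
  rw [schmidtRank_le_iff_exists_sum] at hw ⊢
  obtain ⟨a, b, rfl⟩ := hw
  choose x y hxy using hT
  exact ⟨fun i => x (a i) (b i), fun i => y (a i) (b i), by simp [hxy]⟩

theorem IsLocalUnitary.sNorm_map {U : (H m ⊗[ℂ] H n) →ₗ[ℂ] (H m ⊗[ℂ] H n)}
    (hU : IsLocalUnitary U) (v : H m ⊗[ℂ] H n) : sNorm k (U v) = sNorm k v := by
  -- An isometry that preserves pure tensors carries each competitor `w` for `v` to a competitor `T
  -- w` for `T v` with the same pairing. Using it for `U` and for `star U` gives both inequalities.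
  have hle (T : (H m ⊗[ℂ] H n) →ₗ[ℂ] (H m ⊗[ℂ] H n)) (hT : ∀ x, ‖T x‖ = ‖x‖) (hp : MapsPure T)
      (v : H m ⊗[ℂ] H n) : sNorm k v ≤ sNorm k (T v) := by
    rw [sNorm_eq_sSup k v]
    refine Real.sSup_le ?_ (sNorm_nonneg _)
    rintro _ ⟨w, hw, hr, rfl⟩
    rw [← (⟨T, hT⟩ : (H m ⊗[ℂ] H n) →ₗᵢ[ℂ] (H m ⊗[ℂ] H n)).inner_map_map w v]
    exact norm_inner_le_sNorm ((hT w).trans hw) (hp.schmidtRank_le hr)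
  refine le_antisymm ?_ (hle U ((mem_unitary_iff_norm_map U).1 hU.1) hU.mapsPure v)
  have h := hle (star U) ((mem_unitary_iff_norm_map _).1 (Unitary.star_mem hU.1)) hU.mapsPure_star
    (U v)
  rwa [← Module.End.mul_apply, (Unitary.mem_iff.1 hU.1).1, Module.End.one_apply] at h

end Isometry

end SchmidtNorm

end

theorem theorem5p1 (k m n : ℕ) (hk : 1 ≤ k) (hkmn : k < min m n)
    (U : TensorProduct ℂ (SchmidtNorm.H m) (SchmidtNorm.H n) →ₗ[ℂ]
      TensorProduct ℂ (SchmidtNorm.H m) (SchmidtNorm.H n)) :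
    (∀ v, SchmidtNorm.sNorm k (U v) = SchmidtNorm.sNorm k v) ↔ SchmidtNorm.IsLocalUnitary U :=
  ⟨SchmidtNorm.isLocalUnitary_of_sNorm_map hk hkmn U, fun h v => h.sNorm_map v⟩
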